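/- Let $\mathcal H_A,\mathcal H_E$ be finite-dimensional complex Hilbert spaces, let $\rho$ be a density operator on $\mathcal H_A\otimes\mathcal H_E$ (for instance a pure state), and let $\alpha\in[0,2\pi]$. For a Hermitian operator $G$ on $\mathcal H_A\otimes\mathcal H_E$ put $\rho_G(\alpha)=\mathrm{Tr}_E\!\left[e^{-i\alpha G}\rho\, e^{i\alpha G}\right]$. When $\rho_G(\alpha)$ is invertible, its quantum Fisher information at $\alpha$ is $J(\rho_G)=\mathrm{Tr}\!\left[\rho_G L^2\right]$, where $L$ is the symmetric logarithmic derivative, i.e. the Hermitian operator with $\tfrac12(L\rho_G+\rho_G L)=\partial_\alpha\rho_G$. Let $\|\cdot\|_2$ be the Hilbert--Schmidt norm. Let $G_1,G_2$ be Hermitian operators on $\mathcal H_A\otimes\mathcal H_E$ and $\rho_i=\rho_{G_i}$, such that $\rho_1(\alpha)$ and $\rho_2(\alpha)$ are invertible, with smallest eigenvalues $\lambda_1,\lambda_2>0$. Then, at the parameter value $\alpha$, $$\left|J(\rho_1)-J(\rho_2)\right|\le 2\pi\left\{C_1+C_2\,(\dim\mathcal H_E)\left[1+2\pi\left(\|G_1\|_2+\|G_2\|_2\right)\right]\right\}\|G_1-G_2\|_2,$$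 where $$C_1=\frac{\|\partial_\alpha\rho_1\|_2\,\|\partial_\alpha\rho_2\|_2}{2\lambda_1(\lambda_1+\lambda_2)}+\frac{\|\partial_\alpha\rho_2\|_2^2}{2\lambda_2(\lambda_1+\lambda_2)},\qquad C_2=\frac{\|\partial_\alpha\rho_1\|_2}{2\lambda_1}+\frac{\|\partial_\alpha\rho_2\|_2}{\lambda_1+\lambda_2}.$$ Moreover, for fixed $\rho$ and $\alpha$, the map $G\mapsto J(\rho_G)$ is continuous on the set of Hermitian $G$ for which $\rho_G(\alpha)$ is invertible. -/

import Mathlib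

open Matrix
open scoped ComplexOrder

noncomputable section

/-- The Hilbert-Schmidt (Schatten 2-) norm of a complex matrix, i.e. Mathlib's Frobenius norm. -/
def hsNorm {n : Type*} [Fintype n] (A : Matrix n n ℂ) : ℝ :=
  @norm _ (Matrix.frobeniusNormedAddCommGroup (m := n) (n := n) (α := ℂ)).toNorm A

/-- Density matrices: positive semidefinite of trace one. -/
def IsDensity {n : Type*} [Fintype n] (ρ : Matrix n n ℂ) : Prop :=
  ρ.PosSemidef ∧ ρ.trace = 1

/-- The smallest eigenvalue of a Hermitian matrix (whose spectrum is real and finite). -/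
def minEigenvalue {n : Type*} [Fintype n] [DecidableEq n] (A : Matrix n n ℂ) : ℝ :=
  sInf (spectrum ℝ A)

/-- The partial trace over the second tensor factor. -/
def partialTraceE {a e : Type*} [Fintype e] (M : Matrix (a × e) (a × e) ℂ) : Matrix a a ℂ :=
  Matrix.of fun i j => ∑ k, M (i, k) (j, k)

/-- The unitary `exp(-i α G)` with generator `G`. -/
def evolution {n : Type*} [Fintype n] [DecidableEq n] (G : Matrix n n ℂ) (α : ℝ) :
    Matrix n n ℂ :=
  NormedSpace.exp ((-(Complex.I * (α : ℂ))) • G)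

/-- The reduced state `Tr_E [exp(-i α G) ρ exp(-i α G)†]`, as a function of `α`. -/
def reducedState {a e : Type*} [Fintype a] [Fintype e] [DecidableEq a] [DecidableEq e]
    (G ρ : Matrix (a × e) (a × e) ℂ) (α : ℝ) : Matrix a a ℂ :=
  partialTraceE (evolution G α * ρ * (evolution G α)ᴴ)

/-- `L` is a symmetric logarithmic derivative of the family `ρ` at `α`: it is Hermitian and
`(L ρ_α + ρ_α L) / 2 = ∂_α ρ_α`. -/
def IsSLD {n : Type*} [Fintype n] (ρ : ℝ → Matrix n n ℂ) (α : ℝ) (L : Matrix n n ℂ) : Prop :=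
  L.IsHermitian ∧ (1 / 2 : ℂ) • (L * ρ α + ρ α * L) = deriv ρ α

open Classical in
/-- The quantum Fisher information `J = Tr [ρ_α L_α ^ 2]` of the family `ρ` at `α`, where `L_α` is
a symmetric logarithmic derivative. At a positive definite `ρ_α` it exists and is unique, see
`existsUnique_isSLD`. -/
def qfi {n : Type*} [Fintype n] [DecidableEq n] (ρ : ℝ → Matrix n n ℂ) (α : ℝ) : ℝ :=
  if h : ∃ L, IsSLD ρ α L then ((ρ α * h.choose ^ 2).trace).re else 0

/-- `C₁`, for two families of states at the parameter value `α`. -/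
def constC1 {n : Type*} [Fintype n] [DecidableEq n] (ρ₁ ρ₂ : ℝ → Matrix n n ℂ) (α : ℝ) : ℝ :=
  hsNorm (deriv ρ₁ α) * hsNorm (deriv ρ₂ α) /
      (2 * minEigenvalue (ρ₁ α) * (minEigenvalue (ρ₁ α) + minEigenvalue (ρ₂ α))) +
    hsNorm (deriv ρ₂ α) ^ 2 /
      (2 * minEigenvalue (ρ₂ α) * (minEigenvalue (ρ₁ α) + minEigenvalue (ρ₂ α)))

/-- `C₂`, for two families of states at the parameter value `α`. -/
def constC2 {n : Type*} [Fintype n] [DecidableEq n] (ρ₁ ρ₂ : ℝ → Matrix n n ℂ) (α : ℝ) : ℝ :=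
  hsNorm (deriv ρ₁ α) / (2 * minEigenvalue (ρ₁ α)) +
    hsNorm (deriv ρ₂ α) / (minEigenvalue (ρ₁ α) + minEigenvalue (ρ₂ α))

/-- At a positive definite state the Lyapunov equation defining the symmetric logarithmic derivative
has exactly one solution, so that `qfi` is well defined. -/
theorem existsUnique_isSLD {n : Type*} [Fintype n] [DecidableEq n] (ρ : ℝ → Matrix n n ℂ) (α : ℝ)
    (hρ : (ρ α).PosDef) (hd : (deriv ρ α).IsHermitian) : ∃! L, IsSLD ρ α L := by
  have inj : ∀ X : Matrix n n ℂ, X * ρ α + ρ α * X = 0 → X = 0 := by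
    intro X hX
    have h1 : Xᴴ * ρ α * X = - (Xᴴ * X * ρ α) := by
      have := congrArg (fun Y => Xᴴ * Y) hX
      simp only [mul_add, mul_zero] at this
      rw [mul_assoc, mul_assoc]
      exact eq_neg_of_add_eq_zero_right this
    have h2 : (Xᴴ * ρ α * X).PosSemidef := hρ.posSemidef.conjTranspose_mul_mul_same X
    have h3 : (X * ρ α * Xᴴ).PosSemidef := hρ.posSemidef.mul_mul_conjTranspose_same X
    have h4 : (Xᴴ * ρ α * X).trace = - (X * ρ α * Xᴴ).trace := by
      rw [h1, trace_neg, mul_assoc, trace_mul_comm Xᴴ]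
    have h5 : (Xᴴ * ρ α * X).trace = 0 := by
      have a := h2.trace_nonneg
      have b := h3.trace_nonneg
      rw [h4] at a ⊢
      have : (X * ρ α * Xᴴ).trace = 0 := le_antisymm (neg_nonneg.mp a) b
      rw [this, neg_zero]
    have h6 : Xᴴ * ρ α * X = 0 := h2.trace_eq_zero_iff.mp h5
    ext i j
    by_contra hne
    have hv : X.col j ≠ 0 := fun h => hne (congrFun h i)
    have hp := hρ.dotProduct_mulVec_pos hv
    have : star (X.col j) ⬝ᵥ (ρ α *ᵥ X.col j) = (Xᴴ * ρ α * X) j j := by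
      rw [mul_assoc]
      rfl
    rw [this, h6] at hp
    simp at hp
  let T : Matrix n n ℂ →ₗ[ℂ] Matrix n n ℂ :=
    (1 / 2 : ℂ) • (LinearMap.mulRight ℂ (ρ α) + LinearMap.mulLeft ℂ (ρ α))
  have hT : ∀ X, T X = (1 / 2 : ℂ) • (X * ρ α + ρ α * X) := fun X => rfl
  have hTi : Function.Injective T := by
    rw [← LinearMap.ker_eq_bot, LinearMap.ker_eq_bot']
    intro X hX
    refine inj X ?_
    rw [hT] at hX
    exact (smul_eq_zero.mp hX).resolve_left (by norm_num)
  obtain ⟨L, hL⟩ := (LinearMap.injective_iff_surjective.mp hTi) (deriv ρ α)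
  refine ⟨L, ⟨?_, by rw [← hT, hL]⟩, fun M hM => hTi (by rw [hL, hT, hM.2])⟩
  refine hTi ?_
  rw [hL, ← hd.eq, ← hL, hT, hT, conjTranspose_smul, conjTranspose_add, conjTranspose_mul,
    conjTranspose_mul, hρ.isHermitian.eq, add_comm (ρ α * Lᴴ)]
  congr 1
  simp

end

/-!
Write the state as `ρ = B * Bᴴ` and put `ψᵢ = exp (-i α Gᵢ) * B`, so that the reduced state is the
partial trace of `ψᵢ * ψᵢᴴ`. For Hermitian `L` on the first factor, `Tr [L ρᵢ L]` is the squared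
Hilbert-Schmidt norm of `(L ⊗ 1) ψᵢ`, and `Tr [L ∂ρᵢ] = 2 Re ⟨(L ⊗ 1) ψᵢ, -i Gᵢ ψᵢ⟩`. Everything is
estimated on the level of the `ψᵢ`, so no factor from the partial trace occurs.

With symmetric logarithmic derivatives `Lᵢ`, the Lyapunov equation gives the identity
`J₁ - J₂ = Re Tr [(∂ρ₁ - ∂ρ₂) (L₁ + L₂)] - Re Tr [L₂ (ρ₁ - ρ₂) L₁]` (`fisher_sub_fisher`) and the
bounds `‖Lᵢ‖₂ ≤ ‖∂ρᵢ‖₂ / λᵢ` and `Jᵢ ≤ ‖∂ρᵢ‖₂ ^ 2 / λᵢ`; moreover `Jᵢ ≤ 2 ‖Gᵢ‖₂ ^ 2`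
(`hsNorm_amplify_sld_le`). Duhamel's estimate `norm_evolution_sub_le` controls `ψ₁ - ψ₂`, hence both
terms of the identity (`hsNorm_deriv_sub_le`, `abs_re_trace_mul_reducedState_sub_le`), and also
`√λ₁ - √λ₂` (`sqrt_minEigenvalue_sub_le`). Throughout, a generator may be shifted by a real multiple
of the identity, and the best shift bounds its operator norm by `‖G‖₂ / √2`
(`exists_norm_sub_smul_one_le`).

If `4 λ₁ ≤ 9 λ₂`, the resulting bound of the identity is below the claimed one. Otherwise
`√λ₁ - √λ₂` forces `G₁` and `G₂` apart, and already the bounds of `J₁` and `J₂` suffice. In that case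
the dimension of the first factor is at least two and `λ₁ ≤ 1 / 2`, which is used. The constants are
matched in `abs_sq_sub_sq_le_bound`.

Continuity follows by squeezing, as the same estimates show that `∂ρ` and `λ` depend continuously
on the generator, so that the Lipschitz factor stays bounded near a given generator.
-/

/-! ### Hilbert-Schmidt and operator norms -/

section HilbertSchmidt

open scoped Matrix.Norms.L2Operator

variable {n : Type*} [Fintype n]

/-- The real part of the Hilbert-Schmidt inner product of two matrices. -/
def hsInner (A B : Matrix n n ℂ) : ℝ := (Aᴴ * B).trace.re

theorem hsNorm_nonneg (A : Matrix n n ℂ) : 0 ≤ hsNorm A :=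
  @norm_nonneg _
    (frobeniusNormedAddCommGroup (m := n) (n := n) (α := ℂ)).toNormedAddGroup.toSeminormedAddGroup A

theorem hsNorm_add_le (A B : Matrix n n ℂ) : hsNorm (A + B) ≤ hsNorm A + hsNorm B :=
  @norm_add_le _
    (frobeniusNormedAddCommGroup (m := n) (n := n) (α := ℂ)).toNormedAddGroup.toSeminormedAddGroup A B

theorem hsNorm_sub_comm (A B : Matrix n n ℂ) : hsNorm (A - B) = hsNorm (B - A) :=
  @norm_sub_rev _
    (frobeniusNormedAddCommGroup (m := n) (n := n) (α := ℂ)).toNormedAddGroup.toSeminormedAddGroup A B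

theorem hsNorm_sq_eq_sum (A : Matrix n n ℂ) : hsNorm A ^ 2 = ∑ i, ∑ j, ‖A i j‖ ^ 2 := by
  have h := frobenius_norm_def A
  have h0 : 0 ≤ ∑ i, ∑ j, ‖A i j‖ ^ 2 := by positivity
  have : hsNorm A = (∑ i, ∑ j, ‖A i j‖ ^ 2) ^ (1 / 2 : ℝ) := by
    refine h.trans ?_
    simp
  rw [this, ← Real.sqrt_eq_rpow, Real.sq_sqrt h0]

theorem hsInner_eq_sum (A B : Matrix n n ℂ) :
    hsInner A B = ∑ i, ∑ j, (star (A i j) * B i j).re := by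
  simp only [hsInner, trace, diag_apply, mul_apply, conjTranspose_apply, Complex.re_sum]
  exact Finset.sum_comm

theorem hsInner_self (A : Matrix n n ℂ) : hsInner A A = hsNorm A ^ 2 := by
  rw [hsInner_eq_sum, hsNorm_sq_eq_sum]
  refine Finset.sum_congr rfl fun i _ => Finset.sum_congr rfl fun j _ => ?_
  have : star (A i j) * A i j = ((‖A i j‖ ^ 2 : ℝ) : ℂ) := by
    rw [← starRingEnd_apply, ← Complex.normSq_eq_conj_mul_self, Complex.normSq_eq_norm_sq]
  rw [this, Complex.ofReal_re]

theorem hsNorm_eq_one_of_trace {B : Matrix n n ℂ} (hB : (B * Bᴴ).trace = 1) : hsNorm B = 1 := by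
  have h : hsNorm B ^ 2 = 1 := by
    rw [← hsInner_self, hsInner, trace_mul_comm, hB, Complex.one_re]
  exact (pow_eq_one_iff_of_nonneg (hsNorm_nonneg _) two_ne_zero).mp h

theorem abs_hsInner_le (A B : Matrix n n ℂ) : |hsInner A B| ≤ hsNorm A * hsNorm B := by
  have hA := hsNorm_sq_eq_sum A
  have hB := hsNorm_sq_eq_sum B
  rw [← Fintype.sum_prod_type'] at hA hB
  rw [hsInner_eq_sum, ← Fintype.sum_prod_type']
  calc |∑ x : n × n, (star (A x.1 x.2) * B x.1 x.2).re|
      ≤ ∑ x : n × n, |(star (A x.1 x.2) * B x.1 x.2).re| := Finset.abs_sum_le_sum_abs _ _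
    _ ≤ ∑ x : n × n, ‖A x.1 x.2‖ * ‖B x.1 x.2‖ := by
        refine Finset.sum_le_sum fun x _ => (Complex.abs_re_le_norm _).trans ?_
        rw [norm_mul, norm_star]
    _ ≤ √(∑ x : n × n, ‖A x.1 x.2‖ ^ 2) * √(∑ x : n × n, ‖B x.1 x.2‖ ^ 2) :=
        Real.sum_mul_le_sqrt_mul_sqrt _ _ _
    _ = hsNorm A * hsNorm B := by
        rw [← hA, ← hB, Real.sqrt_sq (hsNorm_nonneg A), Real.sqrt_sq (hsNorm_nonneg B)]

theorem hsInner_sub_right (A B C : Matrix n n ℂ) :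
    hsInner A (B - C) = hsInner A B - hsInner A C := by
  simp [hsInner, mul_sub]

theorem hsInner_sub_left (A B C : Matrix n n ℂ) :
    hsInner (A - B) C = hsInner A C - hsInner B C := by
  simp [hsInner, sub_mul]

theorem hsNorm_I_smul (A : Matrix n n ℂ) : hsNorm ((-Complex.I) • A) = hsNorm A := by
  have h : hsNorm ((-Complex.I) • A) ^ 2 = hsNorm A ^ 2 := by
    simp [hsNorm_sq_eq_sum]
  exact (pow_left_inj₀ (hsNorm_nonneg _) (hsNorm_nonneg _) two_ne_zero).mp h

theorem re_trace_conjTranspose (A : Matrix n n ℂ) : Aᴴ.trace.re = A.trace.re := by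
  rw [trace_conjTranspose, Complex.star_def, Complex.conj_re]

theorem hsInner_comm (A B : Matrix n n ℂ) :
    hsInner A B = hsInner B A := by
  rw [hsInner, hsInner, ← re_trace_conjTranspose, conjTranspose_mul, conjTranspose_conjTranspose]

theorem hsInner_mul_right {H : Matrix n n ℂ} (hH : H.IsHermitian)
    (A B : Matrix n n ℂ) : hsInner A (H * B) = hsInner (H * A) B := by
  rw [hsInner, hsInner, conjTranspose_mul, hH.eq, mul_assoc]

/-- Expectation values of Hermitian matrices are real. -/
theorem hsInner_mul_I_smul {H : Matrix n n ℂ} (hH : H.IsHermitian)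
    (A : Matrix n n ℂ) (c : ℝ) : hsInner (H * A) ((-Complex.I) • ((c : ℂ) • A)) = 0 := by
  have him : (Aᴴ * H * A).trace.im = 0 := by
    rw [← Complex.conj_eq_iff_im, ← Complex.star_def, ← trace_conjTranspose, conjTranspose_mul,
      conjTranspose_mul, conjTranspose_conjTranspose, hH.eq, mul_assoc]
  rw [hsInner, conjTranspose_mul, hH.eq, smul_smul, mul_smul_comm, trace_smul, smul_eq_mul]
  simp [him]

variable [DecidableEq n]

/-- The Hilbert-Schmidt norm is dominated columnwise by the operator norm of the left factor. -/
theorem hsNorm_mul_le (A B : Matrix n n ℂ) : hsNorm (A * B) ≤ ‖A‖ * hsNorm B := by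
  refine abs_le_of_sq_le_sq' ?_ (mul_nonneg (norm_nonneg _) (hsNorm_nonneg _)) |>.2
  rw [mul_pow, hsNorm_sq_eq_sum, hsNorm_sq_eq_sum, Finset.sum_comm,
    Finset.sum_comm (f := fun i j => ‖B i j‖ ^ 2), Finset.mul_sum]
  refine Finset.sum_le_sum fun j _ => ?_
  have h := l2_opNorm_mulVec A (WithLp.toLp 2 (fun i => B i j))
  have h2 := pow_le_pow_left₀ (norm_nonneg _) h 2
  rw [mul_pow, EuclideanSpace.norm_sq_eq, EuclideanSpace.norm_sq_eq] at h2
  exact h2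

/-- The spectral theorem for a Hermitian matrix shifted by a real multiple of the identity. -/
theorem sub_smul_one_eq_unitary_conj {A : Matrix n n ℂ} (hA : A.IsHermitian) (c : ℝ) :
    A - (c : ℂ) • (1 : Matrix n n ℂ) = (hA.eigenvectorUnitary : Matrix n n ℂ) *
      (diagonal (fun i => ((hA.eigenvalues i - c : ℝ) : ℂ)) *
        ((star hA.eigenvectorUnitary : unitary (Matrix n n ℂ)) : Matrix n n ℂ)) := by
  set U := hA.eigenvectorUnitary
  have hsp : A = (U : Matrix n n ℂ) * diagonal (fun i => (hA.eigenvalues i : ℂ)) *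
      star (U : Matrix n n ℂ) := by
    have := hA.spectral_theorem
    rw [Unitary.conjStarAlgAut_apply] at this
    exact this
  have hU : (U : Matrix n n ℂ) * star (U : Matrix n n ℂ) = 1 := Unitary.coe_mul_star_self U
  have h1 : diagonal (fun i => ((hA.eigenvalues i - c : ℝ) : ℂ)) =
      diagonal (fun i => (hA.eigenvalues i : ℂ)) - (c : ℂ) • (1 : Matrix n n ℂ) := by
    rw [← diagonal_one, ← diagonal_smul, diagonal_sub]
    congr 1
    ext i
    simp
  rw [h1, Unitary.coe_star, sub_mul, mul_sub, ← mul_assoc, ← hsp, smul_mul_assoc, one_mul,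
    mul_smul_comm, hU]

theorem hsNorm_sq_eq_sum_eigenvalues {A : Matrix n n ℂ} (hA : A.IsHermitian) :
    hsNorm A ^ 2 = ∑ i, hA.eigenvalues i ^ 2 := by
  have hsp := sub_smul_one_eq_unitary_conj hA 0
  simp only [Complex.ofReal_zero, zero_smul, sub_zero] at hsp
  set U := hA.eigenvectorUnitary
  have hU' : star (U : Matrix n n ℂ) * (U : Matrix n n ℂ) = 1 := Unitary.coe_star_mul_self U
  have hAA : A * A = (U : Matrix n n ℂ) * (diagonal (fun i => ((hA.eigenvalues i ^ 2 : ℝ) : ℂ)) *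
      star (U : Matrix n n ℂ)) := by
    have h : ∀ D : Matrix n n ℂ, (U : Matrix n n ℂ) * (D * star (U : Matrix n n ℂ)) *
        ((U : Matrix n n ℂ) * (D * star (U : Matrix n n ℂ))) =
        (U : Matrix n n ℂ) * (D * (star (U : Matrix n n ℂ) * (U : Matrix n n ℂ)) * D *
        star (U : Matrix n n ℂ)) := fun D => by simp only [mul_assoc]
    conv_lhs => rw [hsp]
    rw [Unitary.coe_star, h, hU', mul_one, diagonal_mul_diagonal]
    simp [sq]
  rw [← hsInner_self, hsInner, hA.eq, hAA, trace_mul_comm, mul_assoc, hU', mul_one,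
    trace_diagonal, Complex.re_sum]
  simp only [Complex.ofReal_re]

/-- Half the spread of the spectrum of a Hermitian matrix is at most its Hilbert-Schmidt norm
divided by `√2`, because `(M - m) ^ 2 ≤ 2 * (M ^ 2 + m ^ 2)`. -/
theorem exists_norm_sub_smul_one_le {A : Matrix n n ℂ} (hA : A.IsHermitian) :
    ∃ c : ℝ, ‖A - (c : ℂ) • (1 : Matrix n n ℂ)‖ ≤ hsNorm A / √2 := by
  rcases isEmpty_or_nonempty n with hn | hn
  · refine ⟨0, ?_⟩
    have : A - ((0 : ℝ) : ℂ) • (1 : Matrix n n ℂ) = 0 := Subsingleton.elim _ _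
    rw [this, norm_zero]
    exact div_nonneg (hsNorm_nonneg A) (Real.sqrt_nonneg 2)
  obtain ⟨i₁, h₁⟩ := Finite.exists_max hA.eigenvalues
  obtain ⟨i₀, h₀⟩ := Finite.exists_min hA.eigenvalues
  set M := hA.eigenvalues i₁
  set m := hA.eigenvalues i₀
  have hspread : ((M - m) / 2) ^ 2 ≤ hsNorm A ^ 2 / 2 := by
    rw [hsNorm_sq_eq_sum_eigenvalues hA]
    by_cases h : i₁ = i₀
    · have : M = m := by simp only [M, m, h]
      rw [this, sub_self, zero_div, zero_pow two_ne_zero]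
      exact div_nonneg (Finset.sum_nonneg fun i _ => sq_nonneg _) zero_le_two
    · have : M ^ 2 + m ^ 2 ≤ ∑ i, hA.eigenvalues i ^ 2 := by
        rw [← Finset.sum_pair (f := fun i => hA.eigenvalues i ^ 2) h]
        exact Finset.sum_le_univ_sum_of_nonneg fun i => sq_nonneg _
      nlinarith [sq_nonneg (M + m)]
  refine ⟨(M + m) / 2, ?_⟩
  rw [sub_smul_one_eq_unitary_conj hA, CStarRing.norm_coe_unitary_mul,
    CStarRing.norm_mul_coe_unitary, l2_opNorm_diagonal,
    pi_norm_le_iff_of_nonneg (div_nonneg (hsNorm_nonneg A) (Real.sqrt_nonneg 2))]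
  intro i
  rw [Complex.norm_real, Real.norm_eq_abs]
  have hle : |hA.eigenvalues i - (M + m) / 2| ≤ (M - m) / 2 := by
    rw [abs_le]
    constructor <;> linarith [h₁ i, h₀ i]
  refine hle.trans (abs_le_of_sq_le_sq' ?_ (div_nonneg (hsNorm_nonneg A) (Real.sqrt_nonneg 2))).2
  rwa [div_pow (hsNorm A), Real.sq_sqrt zero_le_two]

/-- The operator norm of a Hermitian matrix is at most its Hilbert-Schmidt norm. -/
theorem norm_le_hsNorm {A : Matrix n n ℂ}
    (hA : A.IsHermitian) : ‖A‖ ≤ hsNorm A := by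
  have hsp := sub_smul_one_eq_unitary_conj hA 0
  rw [Complex.ofReal_zero, zero_smul, sub_zero] at hsp
  conv_lhs => rw [hsp]
  rw [CStarRing.norm_coe_unitary_mul, CStarRing.norm_mul_coe_unitary, l2_opNorm_diagonal,
    pi_norm_le_iff_of_nonneg (hsNorm_nonneg A)]
  intro i
  rw [Complex.norm_real, Real.norm_eq_abs, sub_zero]
  refine abs_le_of_sq_le_sq ?_ (hsNorm_nonneg A)
  rw [hsNorm_sq_eq_sum_eigenvalues hA]
  exact Finset.single_le_sum (f := fun i => hA.eigenvalues i ^ 2) (fun i _ => sq_nonneg _)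
    (Finset.mem_univ i)

theorem isHermitian_add_smul_one {n : Type*} [DecidableEq n] {G : Matrix n n ℂ}
    (hG : G.IsHermitian) (c : ℝ) : (G + (c : ℂ) • (1 : Matrix n n ℂ)).IsHermitian := by
  rw [IsHermitian, conjTranspose_add, hG.eq, conjTranspose_smul, conjTranspose_one,
    Complex.star_def, Complex.conj_ofReal]

end HilbertSchmidt

open scoped MatrixOrder Matrix.Norms.L2Operator in
theorem exists_eq_mul_conjTranspose {n : Type*} [Fintype n] [DecidableEq n] {A : Matrix n n ℂ}
    (hA : A.PosSemidef) : ∃ B, A = B * Bᴴ :=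
  CStarAlgebra.nonneg_iff_eq_mul_star_self.mp hA.nonneg

/-! ### The partial trace and amplification -/

section PartialTrace

open scoped Kronecker

variable {a e : Type*} [Fintype e]

/-- The partial trace as a real linear map; real scalars are those of the time derivative. -/
def partialTraceLinear : Matrix (a × e) (a × e) ℂ →ₗ[ℝ] Matrix a a ℂ where
  toFun := partialTraceE
  map_add' M N := by
    ext i j
    simp [partialTraceE, Finset.sum_add_distrib]
  map_smul' c M := by
    ext i j
    simp [partialTraceE, Finset.mul_sum]

theorem partialTraceE_add (M N : Matrix (a × e) (a × e) ℂ) :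
    partialTraceE (M + N) = partialTraceE M + partialTraceE N :=
  map_add partialTraceLinear M N

theorem partialTraceE_conjTranspose (M : Matrix (a × e) (a × e) ℂ) :
    (partialTraceE M)ᴴ = partialTraceE Mᴴ := by
  ext i j
  simp [partialTraceE]

theorem trace_partialTraceE [Fintype a] (M : Matrix (a × e) (a × e) ℂ) :
    (partialTraceE M).trace = M.trace := by
  simp [partialTraceE, trace, Fintype.sum_prod_type]

variable [Fintype a] [DecidableEq a] [DecidableEq e]

/-- The amplification `L ↦ L ⊗ 1` of an operator on the first tensor factor to the tensor product,
as a homomorphism of star algebras. -/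
def amplify (a e : Type*) [Fintype a] [DecidableEq a] [Fintype e] [DecidableEq e] :
    Matrix a a ℂ →⋆ₐ[ℂ] Matrix (a × e) (a × e) ℂ where
  toFun L := L ⊗ₖ (1 : Matrix e e ℂ)
  map_one' := one_kronecker_one
  map_mul' L K := by rw [← mul_kronecker_mul, one_mul]
  map_zero' := zero_kronecker _
  map_add' L K := add_kronecker L K _
  commutes' r := by
    rw [Algebra.algebraMap_eq_smul_one, Algebra.algebraMap_eq_smul_one, smul_kronecker,
      one_kronecker_one]
  map_star' L := by
    rw [star_eq_conjTranspose, star_eq_conjTranspose, conjTranspose_kronecker, conjTranspose_one]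

theorem amplify_conjTranspose (L : Matrix a a ℂ) : (amplify a e L)ᴴ = amplify a e Lᴴ :=
  (map_star (amplify a e) L).symm

/-- The partial trace is the dual of the amplification `L ↦ L ⊗ 1`. -/
theorem trace_mul_partialTraceE (L : Matrix a a ℂ) (M : Matrix (a × e) (a × e) ℂ) :
    (L * partialTraceE M).trace = (amplify a e L * M).trace := by
  have h : ∀ i j k l, amplify a e L (i, k) (j, l) = L i j * (1 : Matrix e e ℂ) k l :=
    fun _ _ _ _ => rfl
  simp only [trace, diag_apply, mul_apply, partialTraceE, of_apply, Fintype.sum_prod_type, h,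
    one_apply, mul_ite, mul_one, mul_zero, ite_mul, zero_mul, Finset.sum_ite_eq, Finset.mem_univ,
    if_true, Finset.mul_sum]
  exact Finset.sum_congr rfl fun i _ => Finset.sum_comm

/-- Sesquilinear quantities in a reduced operator become Hilbert-Schmidt inner products of
amplified operators acting on the purifications. -/
theorem re_trace_mul_partialTraceE_mul (L K : Matrix a a ℂ) (X Z : Matrix (a × e) (a × e) ℂ) :
    (L * partialTraceE (X * Zᴴ) * Kᴴ).trace.re =
      hsInner (amplify a e K * Z) (amplify a e L * X) := by
  rw [trace_mul_comm, ← mul_assoc, trace_mul_partialTraceE, hsInner, map_mul, conjTranspose_mul,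
    amplify_conjTranspose, ← mul_assoc, trace_mul_comm]
  simp only [mul_assoc]

open scoped Matrix.Norms.L2Operator in
theorem norm_amplify_le (L : Matrix a a ℂ) : ‖amplify a e L‖ ≤ ‖L‖ :=
  NonUnitalStarAlgHom.norm_apply_le (amplify a e) L

end PartialTrace

/-! ### Unitary evolution and the derivative of the reduced state -/

section Evolution

variable {n : Type*} [Fintype n] [DecidableEq n]

section OperatorNorm

open scoped Matrix.Norms.L2Operator

theorem evolution_mem_unitary {G : Matrix n n ℂ} (hG : G.IsHermitian) (α : ℝ) :
    evolution G α ∈ unitary (Matrix n n ℂ) := by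
  let : NormedAlgebra ℚ (Matrix n n ℂ) := .restrictScalars ℚ ℂ _
  refine NormedSpace.exp_mem_unitary_of_mem_skewAdjoint ?_
  rw [skewAdjoint.mem_iff, star_smul, star_eq_conjTranspose, hG.eq]
  simp

theorem hasDerivAt_evolution (G : Matrix n n ℂ) (α : ℝ) :
    HasDerivAt (evolution G) ((-Complex.I) • G * evolution G α) α := by
  have h := hasDerivAt_exp_smul_const' ((-Complex.I) • G) α
  have he : evolution G = fun u : ℝ => NormedSpace.exp (u • ((-Complex.I) • G)) := by
    ext1 u
    rw [evolution, ← Complex.coe_smul u, smul_smul]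
    congr 2
    ring
  rw [he]
  exact h

/-- Duhamel's estimate: unitary evolution for a time `α` is `α`-Lipschitz in the generator, for
the operator norm. -/
theorem norm_evolution_sub_le {G K : Matrix n n ℂ} (hG : G.IsHermitian) (hK : K.IsHermitian)
    {α : ℝ} (hα : 0 ≤ α) : ‖evolution G α - evolution K α‖ ≤ α * ‖G - K‖ := by
  have hd : ∀ s : ℝ, HasDerivAt (fun s => star (evolution K s) * evolution G s)
      (star (evolution K s) * (Complex.I • (K - G)) * evolution G s) s := fun s => by
    have h := (hasDerivAt_evolution K s).star.mul (hasDerivAt_evolution G s)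
    convert! h using 1
    have hK' : star K = K := hK
    simp only [star_mul, star_smul, hK', star_neg, smul_sub, mul_sub, sub_mul, neg_smul,
      Complex.star_def, Complex.conj_I, neg_neg, neg_mul, mul_neg, ← mul_assoc]
    abel
  have hb : ∀ s : ℝ, ‖star (evolution K s) * (Complex.I • (K - G)) * evolution G s‖ ≤
      ‖G - K‖ := fun s => by
    rw [CStarRing.norm_mul_mem_unitary _ (evolution_mem_unitary hG s),
      CStarRing.norm_mem_unitary_mul _ (Unitary.star_mem (evolution_mem_unitary hK s)), norm_smul,
      Complex.norm_I, one_mul, norm_sub_rev]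
  have h := norm_image_sub_le_of_norm_deriv_le_segment' (a := 0) (b := α)
    (fun s _ => (hd s).hasDerivWithinAt) (fun s _ => hb s) α (Set.right_mem_Icc.2 hα)
  have h0 : ∀ H : Matrix n n ℂ, evolution H 0 = 1 := fun H => by simp [evolution]
  have hU := evolution_mem_unitary hK α
  have heq : evolution G α - evolution K α =
      evolution K α * (star (evolution K α) * evolution G α - 1) := by
    rw [mul_sub, ← mul_assoc, Unitary.mul_star_self_of_mem hU, one_mul, mul_one]
  rw [heq, CStarRing.norm_mem_unitary_mul _ hU]
  simpa [h0, mul_comm] using h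

theorem hsNorm_unitary_mul {U : Matrix n n ℂ} (hU : U ∈ unitary (Matrix n n ℂ))
    (B : Matrix n n ℂ) : hsNorm (U * B) = hsNorm B := by
  have h : hsNorm (U * B) ^ 2 = hsNorm B ^ 2 := by
    rw [← hsInner_self, ← hsInner_self, hsInner, hsInner, conjTranspose_mul, mul_assoc,
      ← mul_assoc Uᴴ, ← star_eq_conjTranspose U, Unitary.star_mul_self_of_mem hU, one_mul]
  exact (pow_left_inj₀ (hsNorm_nonneg _) (hsNorm_nonneg _) two_ne_zero).mp h

/-- Adding a real multiple of the identity to the generator multiplies the evolution by a phase. -/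
theorem evolution_add_smul_one (G : Matrix n n ℂ) (c α : ℝ) :
    evolution (G + (c : ℂ) • (1 : Matrix n n ℂ)) α =
      Complex.exp (-(Complex.I * α * c)) • evolution G α := by
  have h1 : NormedSpace.exp ((-(Complex.I * α * c)) • (1 : Matrix n n ℂ)) =
      Complex.exp (-(Complex.I * α * c)) • (1 : Matrix n n ℂ) := by
    rw [← Algebra.algebraMap_eq_smul_one, ← Algebra.algebraMap_eq_smul_one,
      Complex.exp_eq_exp_ℂ, NormedSpace.algebraMap_exp_comm]
  rw [evolution, evolution, smul_add, smul_smul,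
    Matrix.exp_add_of_commute _ _ (by
      rw [← Algebra.algebraMap_eq_smul_one]
      exact Algebra.commute_algebraMap_right _ _)]
  rw [neg_mul, h1, mul_smul_comm, mul_one]

end OperatorNorm

variable {a e : Type*} [Fintype a] [Fintype e] [DecidableEq a] [DecidableEq e]

/-- Only the generator modulo real multiples of the identity matters for the reduced state. -/
theorem reducedState_add_smul_one (G ρ : Matrix (a × e) (a × e) ℂ) (c : ℝ) :
    reducedState (G + (c : ℂ) • (1 : Matrix (a × e) (a × e) ℂ)) ρ = reducedState G ρ := by
  ext1 α
  have hc : Complex.exp (-(Complex.I * α * c)) * star (Complex.exp (-(Complex.I * α * c))) = 1 := by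
    rw [Complex.star_def, ← Complex.exp_conj, ← Complex.exp_add]
    simp
  rw [reducedState, reducedState, evolution_add_smul_one, conjTranspose_smul, smul_mul_assoc,
    smul_mul_assoc, mul_smul_comm, smul_smul, hc, one_smul]

/-- The derivative of the reduced state. For `ρ = B * Bᴴ` and `ψ = exp (-i α G) * B`, the evolved
state is `ψ * ψᴴ`, and `ψ` moves with velocity `-i G ψ`. -/
theorem deriv_reducedState {G : Matrix (a × e) (a × e) ℂ} (B : Matrix (a × e) (a × e) ℂ) (α : ℝ) :
    deriv (reducedState G (B * Bᴴ)) α =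
      partialTraceE (((-Complex.I) • (G * (evolution G α * B))) * (evolution G α * B)ᴴ) +
        partialTraceE ((evolution G α * B) * ((-Complex.I) • (G * (evolution G α * B)))ᴴ) := by
  let := Matrix.instL2OpNormedAddCommGroup (m := a × e) (n := a × e) (𝕜 := ℂ)
  let := Matrix.instL2OpNormedRing (n := a × e) (𝕜 := ℂ)
  let := Matrix.instL2OpNormedAlgebra (n := a × e) (𝕜 := ℂ)
  let := Matrix.instCStarRing (n := a × e) (𝕜 := ℂ)
  let := Matrix.instL2OpNormedAddCommGroup (m := a) (n := a) (𝕜 := ℂ)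
  let := Matrix.instL2OpNormedSpace (m := a) (n := a) (𝕜 := ℂ)
  have h1 := (hasDerivAt_evolution G α).mul_const B
  have h2 := h1.mul h1.star
  have h3 := (LinearMap.toContinuousLinearMap partialTraceLinear).hasFDerivAt.comp_hasDerivAt α h2
  have h4 : HasDerivAt (reducedState G (B * Bᴴ))
      (partialTraceE ((-Complex.I) • G * evolution G α * B * star (evolution G α * B) +
        evolution G α * B * star ((-Complex.I) • G * evolution G α * B))) α := by
    convert! h3 using 1
    ext1 s
    change _ = partialTraceE ((evolution G s * B) * star (evolution G s * B))
    simp only [reducedState, star_eq_conjTranspose, conjTranspose_mul, mul_assoc]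
  rw [h4.deriv, ← partialTraceE_add]
  simp only [smul_mul_assoc, mul_assoc, star_eq_conjTranspose]

end Evolution

/-! ### The smallest eigenvalue -/

section SmallestEigenvalue

variable {n : Type*} [Fintype n] [DecidableEq n]

theorem exists_eigenvalues_eq_minEigenvalue [Nonempty n] {A : Matrix n n ℂ}
    (hA : A.IsHermitian) :
    ∃ i, hA.eigenvalues i = minEigenvalue A ∧ ∀ j, minEigenvalue A ≤ hA.eigenvalues j := by
  have hs := hA.spectrum_real_eq_range_eigenvalues
  have hfin : (spectrum ℝ A).Finite := hs ▸ Set.finite_range _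
  have hne : (spectrum ℝ A).Nonempty := hs ▸ Set.range_nonempty _
  have hmem : sInf (spectrum ℝ A) ∈ Set.range hA.eigenvalues := hs ▸ hne.csInf_mem hfin
  obtain ⟨i, hi⟩ := hmem
  exact ⟨i, hi, fun j => csInf_le hfin.bddBelow (hA.eigenvalues_mem_spectrum_real j)⟩

theorem minEigenvalue_pos [Nonempty n] {A : Matrix n n ℂ} (hA : A.PosDef) :
    0 < minEigenvalue A := by
  obtain ⟨i, hi, -⟩ := exists_eigenvalues_eq_minEigenvalue hA.isHermitian
  exact hi ▸ hA.eigenvalues_pos i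

/-- This is the trace of `A ≥ λ_min` conjugated by `L`. -/
theorem minEigenvalue_mul_hsNorm_sq_le [Nonempty n] {A : Matrix n n ℂ} (hA : A.IsHermitian)
    (L : Matrix n n ℂ) : minEigenvalue A * hsNorm L ^ 2 ≤ (L * A * Lᴴ).trace.re := by
  obtain ⟨-, -, hmin⟩ := exists_eigenvalues_eq_minEigenvalue hA
  have hpsd : (A - (minEigenvalue A : ℂ) • (1 : Matrix n n ℂ)).PosSemidef := by
    rw [sub_smul_one_eq_unitary_conj hA, ← mul_assoc, Unitary.coe_star, star_eq_conjTranspose]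
    refine PosSemidef.mul_mul_conjTranspose_same (PosSemidef.diagonal fun i => ?_) _
    exact Complex.zero_le_real.mpr (sub_nonneg.mpr (hmin i))
  have h := (Complex.le_def.mp (hpsd.mul_mul_conjTranspose_same L).trace_nonneg).1
  have hLL : (L * Lᴴ).trace.re = hsNorm L ^ 2 := by
    rw [trace_mul_comm, ← hsInner_self, hsInner]
  rw [mul_sub, sub_mul, trace_sub, mul_smul_comm, mul_one, smul_mul_assoc, trace_smul,
    Complex.sub_re, smul_eq_mul, Complex.re_ofReal_mul, hLL, Complex.zero_re] at h
  linarith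

theorem minEigenvalue_mul_card_le [Nonempty n] {A : Matrix n n ℂ} (hA : A.IsHermitian) :
    minEigenvalue A * Fintype.card n ≤ A.trace.re := by
  obtain ⟨-, -, hmin⟩ := exists_eigenvalues_eq_minEigenvalue hA
  have h := Finset.card_nsmul_le_sum Finset.univ hA.eigenvalues _ fun i _ => hmin i
  rw [hA.trace_eq_sum_eigenvalues, Complex.re_sum]
  simpa [mul_comm] using h

theorem minEigenvalue_eq_trace [Nonempty n] [Subsingleton n] {A : Matrix n n ℂ}
    (hA : A.IsHermitian) : minEigenvalue A = A.trace.re := by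
  obtain ⟨i, hi, -⟩ := exists_eigenvalues_eq_minEigenvalue hA
  rw [hA.trace_eq_sum_eigenvalues, Fintype.sum_subsingleton _ i, ← hi]
  simp

/-- In dimension at least two the smallest eigenvalue of a state is at most `1 / 2`, and in
dimension one it is always `1`. -/
theorem minEigenvalue_le_half_or_eq [Nonempty n] {A B : Matrix n n ℂ} (hA : A.PosDef)
    (hB : B.PosDef) (hAt : A.trace = 1) (hBt : B.trace = 1) :
    minEigenvalue A ≤ 1 / 2 ∨ minEigenvalue A = minEigenvalue B := by
  rcases subsingleton_or_nontrivial n with hn | hn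
  · right
    rw [minEigenvalue_eq_trace hA.isHermitian, minEigenvalue_eq_trace hB.isHermitian, hAt, hBt]
  · left
    have h := minEigenvalue_mul_card_le hA.isHermitian
    have hc : (2 : ℝ) ≤ Fintype.card n := by exact_mod_cast Fintype.one_lt_card
    rw [hAt, Complex.one_re] at h
    nlinarith [minEigenvalue_pos hA]

/-- The witness is the projection onto an eigenvector for the smallest eigenvalue. -/
theorem exists_projection_minEigenvalue [Nonempty n] {A : Matrix n n ℂ} (hA : A.IsHermitian) :
    ∃ P : Matrix n n ℂ, P.IsHermitian ∧ hsNorm P = 1 ∧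
      (P * A * Pᴴ).trace.re = minEigenvalue A := by
  obtain ⟨i, hi, -⟩ := exists_eigenvalues_eq_minEigenvalue hA
  set v : n → ℂ := (hA.eigenvectorBasis i).ofLp
  have hvv : star v ⬝ᵥ v = 1 := by
    have h := (EuclideanSpace.inner_eq_star_dotProduct (𝕜 := ℂ) (hA.eigenvectorBasis i)
      (hA.eigenvectorBasis i)).symm
    rw [inner_self_eq_norm_sq_to_K, hA.eigenvectorBasis.orthonormal.1 i] at h
    rw [dotProduct_comm]
    simpa using h
  have hAv : A *ᵥ v = (minEigenvalue A : ℂ) • v := by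
    have h := hA.mulVec_eigenvectorBasis i
    rw [hi] at h
    exact h
  have hP : (vecMulVec v (star v))ᴴ = vecMulVec v (star v) := by
    rw [conjTranspose_vecMulVec, star_star]
  have hPP : vecMulVec v (star v) * vecMulVec v (star v) = vecMulVec v (star v) := by
    rw [vecMulVec_mul_vecMulVec, hvv, one_smul]
  have htr : (vecMulVec v (star v)).trace = 1 := by
    rw [trace_vecMulVec, dotProduct_comm, hvv]
  refine ⟨vecMulVec v (star v), hP, ?_, ?_⟩
  · have h : hsNorm (vecMulVec v (star v)) ^ 2 = 1 := by
      rw [← hsInner_self, hsInner, hP, hPP, htr, Complex.one_re]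
    exact (pow_eq_one_iff_of_nonneg (hsNorm_nonneg _) two_ne_zero).mp h
  · rw [hP, mul_assoc, trace_mul_comm, mul_assoc, hPP, mul_vecMulVec, hAv, smul_vecMulVec,
      trace_smul, htr, smul_eq_mul, mul_one, Complex.ofReal_re]

end SmallestEigenvalue

/-! ### The symmetric logarithmic derivative -/

section LyapunovEquation

variable {n : Type*} [Fintype n] {ρ D L ρ' D' L' : Matrix n n ℂ}

/-- Testing the Lyapunov equation for `L` against a Hermitian `L'`. For `L' = L` the right-hand side
is the Fisher information. -/
theorem re_trace_mul_lyapunov (hρ : ρ.IsHermitian) (hL : L.IsHermitian) (hL' : L'.IsHermitian)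
    (hD : (1 / 2 : ℂ) • (L * ρ + ρ * L) = D) :
    (L' * D).trace.re = (L' * ρ * L).trace.re := by
  have h : (L' * (L * ρ)).trace.re = (L' * ρ * L).trace.re := by
    rw [← re_trace_conjTranspose, conjTranspose_mul, conjTranspose_mul, hρ.eq, hL.eq, hL'.eq,
      trace_mul_comm, mul_assoc]
  rw [← hD, mul_smul_comm, trace_smul, smul_eq_mul, mul_add, trace_add,
    show (1 / 2 : ℂ) = ((1 / 2 : ℝ) : ℂ) by norm_num, Complex.re_ofReal_mul, Complex.add_re, h,
    mul_assoc L' ρ L]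
  ring

/-- The difference of two Fisher informations, split into the change of the derivative and the
change of the state. -/
theorem fisher_sub_fisher (hρ : ρ.IsHermitian) (hρ' : ρ'.IsHermitian) (hL : L.IsHermitian)
    (hL' : L'.IsHermitian) (hD : (1 / 2 : ℂ) • (L * ρ + ρ * L) = D)
    (hD' : (1 / 2 : ℂ) • (L' * ρ' + ρ' * L') = D') :
    (L * ρ * L).trace.re - (L' * ρ' * L').trace.re =
      ((L * (D - D')).trace.re + (L' * (D - D')).trace.re) -
        ((L' * ρ * L).trace.re - (L' * ρ' * L).trace.re) := by
  have h : (L' * ρ' * L).trace.re = (L * ρ' * L').trace.re := by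
    rw [← re_trace_conjTranspose, conjTranspose_mul, conjTranspose_mul, hρ'.eq, hL.eq, hL'.eq,
      mul_assoc]
  rw [mul_sub, mul_sub, trace_sub, trace_sub, Complex.sub_re, Complex.sub_re,
    re_trace_mul_lyapunov hρ hL hL hD, re_trace_mul_lyapunov hρ hL hL' hD,
    re_trace_mul_lyapunov hρ' hL' hL hD', re_trace_mul_lyapunov hρ' hL' hL' hD', h]
  ring

theorem re_trace_mul_le (hL : L.IsHermitian) (D : Matrix n n ℂ) :
    (L * D).trace.re ≤ hsNorm L * hsNorm D := by
  have h := (le_abs_self _).trans (abs_hsInner_le L D)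
  rwa [hsInner, hL.eq] at h

/-- The solution operator of the Lyapunov equation has norm at most `1 / λ_min`. -/
theorem minEigenvalue_mul_hsNorm_le [DecidableEq n] [Nonempty n] (hρ : ρ.IsHermitian)
    (hL : L.IsHermitian) (hD : (1 / 2 : ℂ) • (L * ρ + ρ * L) = D) :
    minEigenvalue ρ * hsNorm L ≤ hsNorm D := by
  have h1 := minEigenvalue_mul_hsNorm_sq_le hρ L
  rw [hL.eq, ← re_trace_mul_lyapunov hρ hL hL hD] at h1
  have h2 := h1.trans (re_trace_mul_le hL D)
  rcases (hsNorm_nonneg L).eq_or_lt with h0 | h0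
  · rw [← h0, mul_zero]
    exact hsNorm_nonneg D
  · refine le_of_mul_le_mul_left ?_ h0
    linarith

end LyapunovEquation

/-! ### Estimates on the level of purifications -/

section PurifiedState

open scoped Matrix.Norms.L2Operator

variable {a e : Type*} [Fintype a] [Fintype e] [DecidableEq a] [DecidableEq e]
variable {G K B : Matrix (a × e) (a × e) ℂ} {L M : Matrix a a ℂ} {α : ℝ}

theorem isHermitian_amplify (hL : L.IsHermitian) : (amplify a e L).IsHermitian := by
  rw [IsHermitian, amplify_conjTranspose, hL.eq]

theorem hsNorm_amplify_mul_le (L : Matrix a a ℂ) (X : Matrix (a × e) (a × e) ℂ) :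
    hsNorm (amplify a e L * X) ≤ ‖L‖ * hsNorm X :=
  (hsNorm_mul_le _ _).trans (mul_le_mul_of_nonneg_right (norm_amplify_le L) (hsNorm_nonneg X))

theorem reducedState_eq (G B : Matrix (a × e) (a × e) ℂ) (α : ℝ) :
    reducedState G (B * Bᴴ) α = partialTraceE ((evolution G α * B) * (evolution G α * B)ᴴ) := by
  simp only [reducedState, conjTranspose_mul, mul_assoc]

theorem isHermitian_reducedState (G B : Matrix (a × e) (a × e) ℂ) (α : ℝ) :
    (reducedState G (B * Bᴴ) α).IsHermitian := by
  rw [reducedState_eq, IsHermitian, partialTraceE_conjTranspose, conjTranspose_mul,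
    conjTranspose_conjTranspose]

theorem trace_reducedState (hG : G.IsHermitian) (B : Matrix (a × e) (a × e) ℂ) (α : ℝ) :
    (reducedState G (B * Bᴴ) α).trace = (B * Bᴴ).trace := by
  rw [reducedState, trace_partialTraceE, trace_mul_comm, ← mul_assoc, ← star_eq_conjTranspose,
    Unitary.star_mul_self_of_mem (evolution_mem_unitary hG α), one_mul]

theorem isHermitian_deriv_reducedState (G B : Matrix (a × e) (a × e) ℂ) (α : ℝ) :
    (deriv (reducedState G (B * Bᴴ)) α).IsHermitian := by
  have h : ∀ X Z : Matrix (a × e) (a × e) ℂ,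
      (partialTraceE (X * Zᴴ))ᴴ = partialTraceE (Z * Xᴴ) := fun X Z => by
    rw [partialTraceE_conjTranspose, conjTranspose_mul, conjTranspose_conjTranspose]
  rw [deriv_reducedState, IsHermitian, conjTranspose_add, h, h, add_comm]

theorem re_trace_mul_reducedState_mul (hM : M.IsHermitian) :
    (L * reducedState G (B * Bᴴ) α * M).trace.re =
      hsInner (amplify a e M * (evolution G α * B)) (amplify a e L * (evolution G α * B)) := by
  rw [reducedState_eq, ← re_trace_mul_partialTraceE_mul, hM.eq]

theorem re_trace_mul_reducedState_mul_self (hL : L.IsHermitian) :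
    (L * reducedState G (B * Bᴴ) α * L).trace.re =
      hsNorm (amplify a e L * (evolution G α * B)) ^ 2 := by
  rw [re_trace_mul_reducedState_mul hL, hsInner_self]

/-- The derivative of the reduced state, tested against `L`. The shift `c` of the generator is
arbitrary because expectation values are real. -/
theorem re_trace_mul_deriv_reducedState (hL : L.IsHermitian) (c : ℝ) :
    (L * deriv (reducedState G (B * Bᴴ)) α).trace.re =
      2 * hsInner (amplify a e L * (evolution G α * B))
        ((-Complex.I) • ((G - (c : ℂ) • (1 : Matrix (a × e) (a × e) ℂ)) *
          (evolution G α * B))) := by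
  have hLa := isHermitian_amplify (e := e) hL
  have h : ∀ X Z : Matrix (a × e) (a × e) ℂ,
      (L * partialTraceE (X * Zᴴ)).trace.re = hsInner Z (amplify a e L * X) := fun X Z => by
    have := re_trace_mul_partialTraceE_mul L 1 X Z
    rwa [conjTranspose_one, mul_one, map_one, one_mul] at this
  rw [deriv_reducedState, mul_add, trace_add, Complex.add_re, h, h, hsInner_mul_right hLa,
    hsInner_comm ((-Complex.I) • _), sub_mul, smul_mul_assoc, one_mul, smul_sub,
    hsInner_sub_right, hsInner_mul_I_smul hLa]
  ring

theorem re_trace_deriv_reducedState (hG : G.IsHermitian) (B : Matrix (a × e) (a × e) ℂ) (α : ℝ) :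
    (deriv (reducedState G (B * Bᴴ)) α).trace.re = 0 := by
  have h := re_trace_mul_deriv_reducedState (G := G) (B := B) (α := α) (isHermitian_one (n := a)) 0
  have h0 := hsInner_mul_I_smul hG (evolution G α * B) 1
  rw [Complex.ofReal_one, one_smul] at h0
  rw [one_mul, map_one, one_mul, Complex.ofReal_zero, zero_smul, sub_zero, ← mul_smul_comm,
    hsInner_mul_right hG, h0, mul_zero] at h
  exact h

theorem hsNorm_evolution_mul (hG : G.IsHermitian) (hB : hsNorm B = 1) :
    hsNorm (evolution G α * B) = 1 :=
  (hsNorm_unitary_mul (evolution_mem_unitary hG α) B).trans hB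

theorem hsNorm_evolution_mul_sub_le (hG : G.IsHermitian) (hK : K.IsHermitian)
    (hB : hsNorm B = 1) (hα : 0 ≤ α) :
    hsNorm (evolution G α * B - evolution K α * B) ≤ α * ‖G - K‖ := by
  rw [← sub_mul]
  refine (hsNorm_mul_le _ _).trans ?_
  rw [hB, mul_one]
  exact norm_evolution_sub_le hG hK hα

/-- The square root of the Fisher information is at most `√2 * hsNorm G`: with `φ = -i (G - c) ψ`
the Fisher information is `2 * hsInner (L ψ) φ`, and `φ` has norm at most `hsNorm G / √2` for a
suitable shift `c`. -/
theorem hsNorm_amplify_sld_le (hG : G.IsHermitian) (hB : hsNorm B = 1)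
    (hL : IsSLD (reducedState G (B * Bᴴ)) α L) :
    hsNorm (amplify a e L * (evolution G α * B)) ≤ √2 * hsNorm G := by
  obtain ⟨c, hc⟩ := exists_norm_sub_smul_one_le hG
  set j := hsNorm (amplify a e L * (evolution G α * B))
  have hj : j ^ 2 ≤ 2 * (j * (hsNorm G / √2)) := by
    rw [← re_trace_mul_reducedState_mul_self hL.1,
      ← re_trace_mul_lyapunov (isHermitian_reducedState G B α) hL.1 hL.1 hL.2,
      re_trace_mul_deriv_reducedState hL.1 c]
    refine mul_le_mul_of_nonneg_left ((le_abs_self _).trans ((abs_hsInner_le _ _).trans ?_))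
      zero_le_two
    refine mul_le_mul_of_nonneg_left ?_ (hsNorm_nonneg _)
    rw [hsNorm_I_smul]
    refine (hsNorm_mul_le _ _).trans ?_
    rwa [hsNorm_evolution_mul hG hB, mul_one]
  have h2 : hsNorm G / √2 * 2 = √2 * hsNorm G := by
    rw [div_mul_eq_mul_div, mul_div_assoc, Real.div_sqrt, mul_comm]
  rcases (show 0 ≤ j from hsNorm_nonneg _).eq_or_lt with h0 | h0
  · rw [← h0]
    exact mul_nonneg (Real.sqrt_nonneg 2) (hsNorm_nonneg G)
  · refine le_of_mul_le_mul_left ?_ h0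
    rw [← h2]
    linarith

/-- The change of the derivative comes from the change `G - K` of the generator, once, and from the
change of the purification, of size `α * ‖G - K‖`, twice. -/
theorem abs_re_trace_mul_deriv_sub_le (hG : G.IsHermitian) (hK : K.IsHermitian)
    (hB : hsNorm B = 1) (hα : 0 ≤ α) (hL : L.IsHermitian) (c : ℝ) :
    |(L * (deriv (reducedState G (B * Bᴴ)) α - deriv (reducedState K (B * Bᴴ)) α)).trace.re| ≤
      2 * ‖L‖ * ‖G - K‖ * (1 + 2 * α * ‖K - (c : ℂ) • (1 : Matrix (a × e) (a × e) ℂ)‖) := by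
  set ψ := evolution G α * B
  set χ := evolution K α * B
  set κ := ‖G - K‖
  set k := ‖K - (c : ℂ) • (1 : Matrix (a × e) (a × e) ℂ)‖
  have hψ : hsNorm ψ = 1 := hsNorm_evolution_mul hG hB
  have hχ : hsNorm χ = 1 := hsNorm_evolution_mul hK hB
  have hδ : hsNorm (ψ - χ) ≤ α * κ := hsNorm_evolution_mul_sub_le hG hK hB hα
  set φ := (-Complex.I) • ((G - (c : ℂ) • (1 : Matrix (a × e) (a × e) ℂ)) * ψ)
  set η := (-Complex.I) • ((K - (c : ℂ) • (1 : Matrix (a × e) (a × e) ℂ)) * χ)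
  have hη : hsNorm η ≤ k := by
    refine (hsNorm_I_smul _).trans_le ((hsNorm_mul_le _ _).trans ?_)
    rw [hχ, mul_one]
  have hφη : hsNorm (φ - η) ≤ κ + k * (α * κ) := by
    have h : φ - η = (-Complex.I) • ((G - K) * ψ +
        (K - (c : ℂ) • (1 : Matrix (a × e) (a × e) ℂ)) * (ψ - χ)) := by
      rw [← smul_sub]
      congr 1
      simp only [sub_mul, mul_sub]
      abel
    rw [h, hsNorm_I_smul]
    refine (hsNorm_add_le _ _).trans (add_le_add ?_ ?_)
    · refine (hsNorm_mul_le _ _).trans ?_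
      rw [hψ, mul_one]
    · exact (hsNorm_mul_le _ _).trans (mul_le_mul_of_nonneg_left hδ (norm_nonneg _))
  have hsplit : (L * (deriv (reducedState G (B * Bᴴ)) α -
      deriv (reducedState K (B * Bᴴ)) α)).trace.re =
      2 * (hsInner (amplify a e L * ψ) (φ - η) + hsInner (amplify a e L * (ψ - χ)) η) := by
    rw [mul_sub, trace_sub, Complex.sub_re, re_trace_mul_deriv_reducedState hL c,
      re_trace_mul_deriv_reducedState hL c, mul_sub, hsInner_sub_right, hsInner_sub_left]
    ring
  rw [hsplit, abs_mul, abs_two]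
  have h1 : |hsInner (amplify a e L * ψ) (φ - η)| ≤ ‖L‖ * (κ + k * (α * κ)) := by
    refine (abs_hsInner_le _ _).trans (mul_le_mul ?_ hφη (hsNorm_nonneg _) (norm_nonneg _))
    exact (hsNorm_amplify_mul_le _ _).trans_eq (by rw [hψ, mul_one])
  have h2 : |hsInner (amplify a e L * (ψ - χ)) η| ≤ ‖L‖ * (α * κ) * k := by
    refine (abs_hsInner_le _ _).trans (mul_le_mul ?_ hη (hsNorm_nonneg _)
      (mul_nonneg (norm_nonneg _) (mul_nonneg hα (norm_nonneg _))))
    exact (hsNorm_amplify_mul_le _ _).trans (mul_le_mul_of_nonneg_left hδ (norm_nonneg _))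
  have h3 := abs_add_le (hsInner (amplify a e L * ψ) (φ - η))
    (hsInner (amplify a e L * (ψ - χ)) η)
  linarith

/-- The derivative of the reduced state is Lipschitz in the generator. It is tested against
itself; being traceless and Hermitian, it can be shifted in the test, which gains a factor `√2`. -/
theorem hsNorm_deriv_sub_le_right (hG : G.IsHermitian) (hK : K.IsHermitian)
    (hB : hsNorm B = 1) (hα : 0 ≤ α) :
    hsNorm (deriv (reducedState G (B * Bᴴ)) α - deriv (reducedState K (B * Bᴴ)) α) ≤
      hsNorm (G - K) * (1 + √2 * α * hsNorm K) := by
  obtain ⟨c, hc⟩ := exists_norm_sub_smul_one_le (hG.sub hK)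
  obtain ⟨b, hb⟩ := exists_norm_sub_smul_one_le hK
  set K' := K + (c : ℂ) • (1 : Matrix (a × e) (a × e) ℂ)
  have hK' : K'.IsHermitian := isHermitian_add_smul_one hK c
  have hGK' : ‖G - K'‖ ≤ hsNorm (G - K) / √2 := by rwa [← sub_sub]
  have hKb : ‖K' - ((b + c : ℝ) : ℂ) • (1 : Matrix (a × e) (a × e) ℂ)‖ ≤ hsNorm K / √2 := by
    rwa [Complex.ofReal_add, add_smul, add_sub_add_right_eq_sub]
  rw [← reducedState_add_smul_one K (B * Bᴴ) c]
  set X := deriv (reducedState G (B * Bᴴ)) α - deriv (reducedState K' (B * Bᴴ)) α with hX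
  have hXh : X.IsHermitian :=
    (isHermitian_deriv_reducedState G B α).sub (isHermitian_deriv_reducedState K' B α)
  have hXt : X.trace.re = 0 := by
    rw [hX, trace_sub, Complex.sub_re, re_trace_deriv_reducedState hG,
      re_trace_deriv_reducedState hK', sub_zero]
  clear_value X
  obtain ⟨x, hx⟩ := exists_norm_sub_smul_one_le hXh
  set Y := X - (x : ℂ) • (1 : Matrix a a ℂ) with hY
  have hYh : Y.IsHermitian := by
    have h := isHermitian_add_smul_one hXh (-x)
    rwa [Complex.ofReal_neg, neg_smul, ← sub_eq_add_neg] at h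
  have hsq : hsNorm X ^ 2 = (Y * X).trace.re := by
    rw [← hsInner_self, hsInner, hXh.eq, hY, sub_mul, trace_sub, Complex.sub_re, smul_mul_assoc,
      one_mul, trace_smul, smul_eq_mul, Complex.re_ofReal_mul, hXt, mul_zero, sub_zero]
  have hbound := (le_abs_self _).trans
    (abs_re_trace_mul_deriv_sub_le hG hK' hB hα hYh (b + c))
  rw [← hX, ← hsq] at hbound
  set s := √2 with hs
  have hs0 : 0 < s := Real.sqrt_pos.mpr zero_lt_two
  have hss : s * s = 2 := Real.mul_self_sqrt zero_le_two
  have hfinal : hsNorm X ^ 2 ≤ hsNorm X * (hsNorm (G - K) * (1 + s * α * hsNorm K)) := by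
    have hx0 := hsNorm_nonneg X
    have hGK0 := hsNorm_nonneg (G - K)
    have hdiv : ∀ y : ℝ, y / s = y * s / 2 := fun y => by
      rw [div_eq_div_iff hs0.ne' two_ne_zero, mul_assoc, hss]
    calc hsNorm X ^ 2
        ≤ 2 * (hsNorm X / s) * (hsNorm (G - K) / s) * (1 + 2 * α * (hsNorm K / s)) := by
          refine hbound.trans ?_
          gcongr
      _ = hsNorm X * (hsNorm (G - K) * (1 + s * α * hsNorm K)) := by
          simp only [hdiv]
          linear_combination hsNorm X * hsNorm (G - K) / 2 * (1 + s * α * hsNorm K) * hss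
  rcases (hsNorm_nonneg X).eq_or_lt with h0 | h0
  · rw [← h0]
    exact mul_nonneg (hsNorm_nonneg _) (add_nonneg zero_le_one
      (mul_nonneg (mul_nonneg hs0.le hα) (hsNorm_nonneg _)))
  · refine le_of_mul_le_mul_left ?_ h0
    rwa [← sq]

/-- The symmetric form of `hsNorm_deriv_sub_le_right`, by averaging over the two orders. -/
theorem hsNorm_deriv_sub_le (hG : G.IsHermitian) (hK : K.IsHermitian) (hB : hsNorm B = 1)
    (hα : α ∈ Set.Icc 0 (2 * Real.pi)) :
    hsNorm (deriv (reducedState G (B * Bᴴ)) α - deriv (reducedState K (B * Bᴴ)) α) ≤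
      (1 + √2 * Real.pi * (hsNorm G + hsNorm K)) * hsNorm (G - K) := by
  have h1 := hsNorm_deriv_sub_le_right hG hK hB hα.1
  have h2 := hsNorm_deriv_sub_le_right hK hG hB hα.1
  rw [hsNorm_sub_comm, hsNorm_sub_comm K G] at h2
  have hS : α * (√2 * (hsNorm G + hsNorm K)) ≤
      2 * Real.pi * (√2 * (hsNorm G + hsNorm K)) :=
    mul_le_mul_of_nonneg_right hα.2 (mul_nonneg (Real.sqrt_nonneg 2)
      (add_nonneg (hsNorm_nonneg G) (hsNorm_nonneg K)))
  nlinarith [mul_le_mul_of_nonneg_right hS (hsNorm_nonneg (G - K))]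

/-- The shift `c` changes the second purification by a phase, which the reduced state ignores; the
best phase gains a factor `√2`. -/
theorem exists_shift_hsNorm_evolution_sub_le (hG : G.IsHermitian) (hK : K.IsHermitian)
    (hB : hsNorm B = 1) (hα : α ∈ Set.Icc 0 (2 * Real.pi)) :
    ∃ c : ℝ, hsNorm (evolution G α * B -
      evolution (K + (c : ℂ) • (1 : Matrix (a × e) (a × e) ℂ)) α * B) ≤
        √2 * Real.pi * hsNorm (G - K) := by
  obtain ⟨c, hc⟩ := exists_norm_sub_smul_one_le (hG.sub hK)
  refine ⟨c, (hsNorm_evolution_mul_sub_le hG (isHermitian_add_smul_one hK c) hB hα.1).trans ?_⟩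
  rw [sub_sub] at hc
  calc α * ‖G - (K + (c : ℂ) • (1 : Matrix (a × e) (a × e) ℂ))‖
      ≤ 2 * Real.pi * (hsNorm (G - K) / √2) :=
        mul_le_mul hα.2 hc (norm_nonneg _) Real.two_pi_pos.le
    _ = 2 / √2 * Real.pi * hsNorm (G - K) := by ring
    _ = √2 * Real.pi * hsNorm (G - K) := by rw [Real.div_sqrt]

/-- The square root of the smallest eigenvalue, being the smallest Schmidt coefficient of the
purification, is a Lipschitz function of the generator. -/
theorem sqrt_minEigenvalue_sub_le [Nonempty a] (hG : G.IsHermitian) (hK : K.IsHermitian)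
    (hB : hsNorm B = 1) (hα : α ∈ Set.Icc 0 (2 * Real.pi)) :
    √(minEigenvalue (reducedState G (B * Bᴴ) α)) -
      √(minEigenvalue (reducedState K (B * Bᴴ) α)) ≤ √2 * Real.pi * hsNorm (G - K) := by
  obtain ⟨c, hc⟩ := exists_shift_hsNorm_evolution_sub_le hG hK hB hα
  rw [← reducedState_add_smul_one K (B * Bᴴ) c]
  set K' := K + (c : ℂ) • (1 : Matrix (a × e) (a × e) ℂ)
  obtain ⟨P, hP, hP1, hPK⟩ := exists_projection_minEigenvalue (isHermitian_reducedState K' B α)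
  have hPG := minEigenvalue_mul_hsNorm_sq_le (isHermitian_reducedState G B α) P
  rw [hP.eq, re_trace_mul_reducedState_mul_self hP] at hPK hPG
  rw [hP1, one_pow, mul_one] at hPG
  rw [← hPK, Real.sqrt_sq (hsNorm_nonneg _), sub_le_iff_le_add]
  refine (Real.sqrt_le_sqrt hPG).trans ?_
  rw [Real.sqrt_sq (hsNorm_nonneg _)]
  have hsplit : amplify a e P * (evolution G α * B) =
      amplify a e P * (evolution G α * B - evolution K' α * B) +
        amplify a e P * (evolution K' α * B) := by
    rw [← mul_add, sub_add_cancel]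
  rw [hsplit]
  refine (hsNorm_add_le _ _).trans (add_le_add ?_ le_rfl)
  refine (hsNorm_amplify_mul_le _ _).trans ((mul_le_of_le_one_left (hsNorm_nonneg _) ?_).trans hc)
  exact hP1 ▸ norm_le_hsNorm hP

/-- The change of the state, tested against two Hermitian matrices. The square
roots on the right are those of the Fisher informations when `L` and `M` are the symmetric
logarithmic derivatives. -/
theorem abs_re_trace_mul_reducedState_sub_le (hG : G.IsHermitian) (hK : K.IsHermitian)
    (hB : hsNorm B = 1) (hα : α ∈ Set.Icc 0 (2 * Real.pi)) (hL : L.IsHermitian)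
    (hM : M.IsHermitian) :
    |(M * reducedState G (B * Bᴴ) α * L).trace.re -
        (M * reducedState K (B * Bᴴ) α * L).trace.re| ≤
      √2 * Real.pi * hsNorm (G - K) *
        (√((L * reducedState G (B * Bᴴ) α * L).trace.re) * hsNorm M +
          √((M * reducedState K (B * Bᴴ) α * M).trace.re) * hsNorm L) := by
  obtain ⟨c, hc⟩ := exists_shift_hsNorm_evolution_sub_le hG hK hB hα
  rw [← reducedState_add_smul_one K (B * Bᴴ) c]
  set K' := K + (c : ℂ) • (1 : Matrix (a × e) (a × e) ℂ)
  set ψ := evolution G α * B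
  set χ := evolution K' α * B
  rw [re_trace_mul_reducedState_mul_self hL, re_trace_mul_reducedState_mul_self hM,
    re_trace_mul_reducedState_mul hL, re_trace_mul_reducedState_mul hL,
    Real.sqrt_sq (hsNorm_nonneg _), Real.sqrt_sq (hsNorm_nonneg _)]
  have hsplit : hsInner (amplify a e L * ψ) (amplify a e M * ψ) -
      hsInner (amplify a e L * χ) (amplify a e M * χ) =
      hsInner (amplify a e L * ψ) (amplify a e M * (ψ - χ)) +
        hsInner (amplify a e L * (ψ - χ)) (amplify a e M * χ) := by
    rw [mul_sub, mul_sub, hsInner_sub_right, hsInner_sub_left]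
    ring
  have hle : ∀ {N : Matrix a a ℂ}, N.IsHermitian → hsNorm (amplify a e N * (ψ - χ)) ≤
      hsNorm N * (√2 * Real.pi * hsNorm (G - K)) := fun hN =>
    (hsNorm_amplify_mul_le _ _).trans
      (mul_le_mul (norm_le_hsNorm hN) hc (hsNorm_nonneg _) (hsNorm_nonneg _))
  rw [hsplit]
  have h1 := (abs_hsInner_le (amplify a e L * ψ) (amplify a e M * (ψ - χ))).trans
    (mul_le_mul_of_nonneg_left (hle hM) (hsNorm_nonneg _))
  have h2 := (abs_hsInner_le (amplify a e L * (ψ - χ)) (amplify a e M * χ)).trans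
    (mul_le_mul_of_nonneg_right (hle hL) (hsNorm_nonneg _))
  refine (abs_add_le _ _).trans ((add_le_add h1 h2).trans_eq ?_)
  ring

end PurifiedState

/-! ### The inequality between real numbers -/

section RealInequality

/-- The direct estimate is below the claimed bound as long as `p ≤ 9 / 4 * q`: then `l₁ + l₂` is at
most `13 / 4` times the constant `C₂`. Here `s` stands for `√2`. -/
theorem le_bound_of_comparable {d₁ d₂ l₁ l₂ p q s j₁ j₂ g₁ g₂ t : ℝ} (hp : 0 < p)
    (hq : 0 < q) (hd₂ : 0 ≤ d₂) (hl₁ : 0 ≤ l₁) (hl₂ : 0 ≤ l₂)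
    (hg₁ : 0 ≤ g₁) (hg₂ : 0 ≤ g₂) (ht : 0 ≤ t) (hs : 0 ≤ s) (hss : s * s = 2)
    (h₁ : p * l₁ ≤ d₁) (h₂ : q * l₂ ≤ d₂) (hj₁ : j₁ ≤ s * g₁) (hj₂ : j₂ ≤ s * g₂)
    (hpq : 4 * p ≤ 9 * q) :
    (1 + s * Real.pi * (g₁ + g₂)) * t * (l₁ + l₂) + s * Real.pi * t * (j₁ * l₂ + j₂ * l₁) ≤
      2 * Real.pi * ((d₁ / (2 * p) + d₂ / (p + q)) * (1 + 2 * Real.pi * (g₁ + g₂))) * t := by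
  set C := d₁ / (2 * p) + d₂ / (p + q)
  have hC : l₁ + l₂ ≤ 13 / 4 * C := by
    have e₁ : l₁ ≤ 2 * (d₁ / (2 * p)) := by
      rw [mul_div_assoc', mul_div_mul_left _ _ two_ne_zero, le_div_iff₀ hp]
      linarith
    have e₂ : l₂ ≤ 13 / 4 * (d₂ / (p + q)) := by
      rw [mul_div_assoc', le_div_iff₀ (add_pos hp hq)]
      nlinarith
    have e₃ : 0 ≤ d₁ / (2 * p) := by linarith
    simp only [C]
    linarith
  have hpi := Real.pi_gt_three
  have hs2 : s ≤ 3 / 2 := by nlinarith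
  have hC0 : 0 ≤ C := by linarith
  have hj : j₁ * l₂ + j₂ * l₁ ≤ s * (g₁ + g₂) * (l₁ + l₂) := by
    nlinarith [mul_le_mul_of_nonneg_right hj₁ hl₂, mul_le_mul_of_nonneg_right hj₂ hl₁,
      mul_nonneg (mul_nonneg hs hg₁) hl₁, mul_nonneg (mul_nonneg hs hg₂) hl₂]
  set S := g₁ + g₂
  have hS : 0 ≤ S := add_nonneg hg₁ hg₂
  set l := l₁ + l₂
  have hpS : 0 ≤ Real.pi * S := mul_nonneg Real.pi_pos.le hS
  calc (1 + s * Real.pi * S) * t * l + s * Real.pi * t * (j₁ * l₂ + j₂ * l₁)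
      ≤ (1 + s * Real.pi * S) * t * l + s * Real.pi * t * (s * S * l) := by gcongr
    _ = (1 + (s + 2) * (Real.pi * S)) * t * l := by linear_combination Real.pi * t * S * l * hss
    _ ≤ (1 + (3 / 2 + 2) * (Real.pi * S)) * t * (13 / 4 * C) := by gcongr
    _ = (13 / 4 * (1 + 7 / 2 * (Real.pi * S))) * (C * t) := by ring
    _ ≤ (2 * Real.pi * (1 + 2 * (Real.pi * S))) * (C * t) := by
        refine mul_le_mul_of_nonneg_right ?_ (mul_nonneg hC0 ht)
        nlinarith
    _ = 2 * Real.pi * (C * (1 + 2 * Real.pi * S)) * t := by ring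

/-- If the smallest eigenvalues `m ^ 2` and `n ^ 2` are far apart, so are the generators, and the
Fisher information `j ^ 2` of the state with the larger one is itself below the claimed bound. -/
theorem sq_le_bound_of_large {d g j m n t s : ℝ} (hm : 0 < m) (hg : 0 ≤ g) (hj : 0 ≤ j)
    (hs : 0 < s) (hss : s * s = 2) (hd : j * m ≤ d) (hjg : j ≤ s * g)
    (hmn : 3 * n ≤ 2 * m) (hw : m - n ≤ s * Real.pi * t) :
    j ^ 2 ≤ 2 * Real.pi * (d / (2 * m ^ 2) * (2 * Real.pi * g)) * t := by
  have hpi := Real.pi_gt_three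
  have hd0 : 0 ≤ d := (mul_nonneg hj hm.le).trans hd
  have h1 : m ≤ Real.pi * (s * Real.pi * t) := by nlinarith
  have h2 : j ^ 2 * m ^ 2 ≤ d * (s * g) * m := by
    have := mul_le_mul hd hjg hj hd0
    nlinarith
  have h3 : d * (s * g) * m ≤ d * (s * g) * (Real.pi * (s * Real.pi * t)) :=
    mul_le_mul_of_nonneg_left h1 (mul_nonneg hd0 (mul_nonneg hs.le hg))
  have h4 : 2 * Real.pi * (d / (2 * m ^ 2) * (2 * Real.pi * g)) * t =
      d * (s * g) * (Real.pi * (s * Real.pi * t)) / m ^ 2 := by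
    field_simp
    linear_combination -(d * g * t) * hss
  rw [h4, le_div_iff₀ (by positivity)]
  exact h2.trans h3

/-- The analogue of `sq_le_bound_of_large` for the Fisher information `j ^ 2` of the state with the
smaller smallest eigenvalue `n ^ 2`. Here both constants `C₁` and `C₂` are needed, and
`m ^ 2 ≤ 1 / 2`. -/
theorem sq_le_bound_of_small {d g j m n t s : ℝ} (hm : 0 < m) (hn : 0 < n)
    (hj : 0 ≤ j) (hs : 0 < s) (hss : s * s = 2) (hd : j * n ≤ d) (hjg : j ≤ s * g)
    (hmn : 3 * n ≤ 2 * m) (hm2 : m ^ 2 ≤ 1 / 2) (hw : m - n ≤ s * Real.pi * t) :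
    j ^ 2 ≤ 2 * Real.pi * (d ^ 2 / (2 * n ^ 2 * (m ^ 2 + n ^ 2)) +
      d / (m ^ 2 + n ^ 2) * (2 * Real.pi * g)) * t := by
  have hpi := Real.pi_gt_three
  have hd0 : 0 ≤ d := (mul_nonneg hj hn.le).trans hd
  have hg0 : 0 ≤ g := by nlinarith
  have ht0 : 0 ≤ t := by
    have h : 0 < s * Real.pi := mul_pos hs Real.pi_pos
    by_contra! hneg
    nlinarith
  have e₁ : j ^ 2 ≤ d ^ 2 / n ^ 2 := by
    rw [le_div_iff₀ (by positivity), ← mul_pow]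
    gcongr
  have e₂ : j ^ 2 * n ≤ s * (d * g) := by nlinarith [mul_le_mul hd hjg hj hd0]
  have hsm : s * m ≤ 1 := by
    have : (s * m) ^ 2 ≤ 1 := by nlinarith
    nlinarith [mul_pos hs hm]
  -- equivalent to `7 * n ≤ 5 * m`; this holds as `2 / 3 < 5 / 7`
  have hquad : m ^ 2 + n ^ 2 ≤ (m - n) * (m + 6 * n) := by nlinarith
  have hmn0 : 0 ≤ m - n := by linarith
  have hfac : (m - n) * (m + 6 * n) ≤ (s * Real.pi * t) * (s / 2 + 2 * Real.pi * n) := by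
    refine mul_le_mul hw ?_ (by positivity) (by positivity)
    nlinarith
  have hkey : j ^ 2 * (m ^ 2 + n ^ 2) ≤
      2 * Real.pi * (d ^ 2 / n ^ 2 / 2 + d * (2 * Real.pi * g)) * t := by
    calc j ^ 2 * (m ^ 2 + n ^ 2)
        ≤ j ^ 2 * ((s * Real.pi * t) * (s / 2 + 2 * Real.pi * n)) :=
          mul_le_mul_of_nonneg_left (hquad.trans hfac) (sq_nonneg j)
      _ = Real.pi * t * (j ^ 2 + 2 * Real.pi * s * (j ^ 2 * n)) := by
          linear_combination (Real.pi * t * j ^ 2 / 2) * hss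
      _ ≤ Real.pi * t * (d ^ 2 / n ^ 2 + 2 * Real.pi * s * (s * (d * g))) := by gcongr
      _ = 2 * Real.pi * (d ^ 2 / n ^ 2 / 2 + d * (2 * Real.pi * g)) * t := by
          linear_combination (2 * Real.pi ^ 2 * t * d * g) * hss
  have h4 : 2 * Real.pi * (d ^ 2 / (2 * n ^ 2 * (m ^ 2 + n ^ 2)) +
      d / (m ^ 2 + n ^ 2) * (2 * Real.pi * g)) * t =
      2 * Real.pi * (d ^ 2 / n ^ 2 / 2 + d * (2 * Real.pi * g)) * t / (m ^ 2 + n ^ 2) := by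
    field_simp
  rw [h4, le_div_iff₀ (by positivity)]
  exact hkey

/-- The elementary inequality behind the theorem, with `p`, `q` the smallest eigenvalues, `dᵢ` the
norms of the derivatives, `lᵢ` those of the symmetric logarithmic derivatives, `jᵢ ^ 2` the Fisher
informations and `t` the distance of the generators. -/
theorem abs_sq_sub_sq_le_bound {d₁ d₂ l₁ l₂ p q j₁ j₂ g₁ g₂ t N : ℝ} (hp : 0 < p)
    (hq : 0 < q) (hl₁ : 0 ≤ l₁) (hl₂ : 0 ≤ l₂)
    (hj₁ : 0 ≤ j₁) (hj₂ : 0 ≤ j₂) (hg₁ : 0 ≤ g₁) (hg₂ : 0 ≤ g₂) (ht : 0 ≤ t) (hN : 1 ≤ N)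
    (h₁ : p * l₁ ≤ d₁) (h₂ : q * l₂ ≤ d₂) (hjd₁ : j₁ ^ 2 ≤ l₁ * d₁) (hjd₂ : j₂ ^ 2 ≤ l₂ * d₂)
    (hjg₁ : j₁ ≤ √2 * g₁) (hjg₂ : j₂ ≤ √2 * g₂) (hw : √p - √q ≤ √2 * Real.pi * t)
    (hdim : p ≤ 1 / 2 ∨ p = q)
    (h : |j₁ ^ 2 - j₂ ^ 2| ≤ (1 + √2 * Real.pi * (g₁ + g₂)) * t * (l₁ + l₂) +
      √2 * Real.pi * t * (j₁ * l₂ + j₂ * l₁)) :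
    |j₁ ^ 2 - j₂ ^ 2| ≤ 2 * Real.pi * (d₁ * d₂ / (2 * p * (p + q)) + d₂ ^ 2 / (2 * q * (p + q)) +
      (d₁ / (2 * p) + d₂ / (p + q)) * N * (1 + 2 * Real.pi * (g₁ + g₂))) * t := by
  have hd₁ : 0 ≤ d₁ := (mul_nonneg hp.le hl₁).trans h₁
  have hd₂ : 0 ≤ d₂ := (mul_nonneg hq.le hl₂).trans h₂
  have hs : 0 < √2 := Real.sqrt_pos.mpr zero_lt_two
  have hss : √2 * √2 = 2 := Real.mul_self_sqrt zero_le_two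
  have hπ := Real.pi_pos
  have hR : 2 * Real.pi * (d₁ * d₂ / (2 * p * (p + q)) + d₂ ^ 2 / (2 * q * (p + q)) +
        (d₁ / (2 * p) + d₂ / (p + q)) * 1 * (1 + 2 * Real.pi * (g₁ + g₂))) * t ≤
      2 * Real.pi * (d₁ * d₂ / (2 * p * (p + q)) + d₂ ^ 2 / (2 * q * (p + q)) +
        (d₁ / (2 * p) + d₂ / (p + q)) * N * (1 + 2 * Real.pi * (g₁ + g₂))) * t := by
    gcongr
  refine le_trans ?_ hR
  rw [mul_one]
  have z₁ : 0 ≤ d₁ * d₂ / (2 * p * (p + q)) := by positivity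
  have z₂ : 0 ≤ d₂ ^ 2 / (2 * q * (p + q)) := by positivity
  have z₃ : 0 ≤ d₁ / (2 * p) := by positivity
  have z₄ : 0 ≤ d₂ / (p + q) := by positivity
  have mono : ∀ {x y : ℝ}, x ≤ y → 2 * Real.pi * x * t ≤ 2 * Real.pi * y * t := fun hxy =>
    mul_le_mul_of_nonneg_right (mul_le_mul_of_nonneg_left hxy Real.two_pi_pos.le) ht
  rcases le_or_gt (4 * p) (9 * q) with hpq | hpq
  · refine h.trans ((le_bound_of_comparable hp hq hd₂ hl₁ hl₂ hg₁ hg₂ ht hs.le hss h₁ h₂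
      hjg₁ hjg₂ hpq).trans (mono ?_))
    linarith
  -- the spectra differ so much that the generators are far apart
  · have hp2 : √p ^ 2 = p := Real.sq_sqrt hp.le
    have hq2 : √q ^ 2 = q := Real.sq_sqrt hq.le
    have hm : 0 < √p := Real.sqrt_pos.mpr hp
    have hn : 0 < √q := Real.sqrt_pos.mpr hq
    have hmn : 3 * √q ≤ 2 * √p := by nlinarith
    have hhalf : √p ^ 2 ≤ 1 / 2 := by
      rcases hdim with hd | hd <;> linarith
    have k₁ : j₁ * √p ≤ d₁ := by
      refine abs_le_of_sq_le_sq' ?_ hd₁ |>.2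
      rw [mul_pow, hp2]
      linarith [mul_le_mul_of_nonneg_right hjd₁ hp.le,
        mul_le_mul_of_nonneg_right h₁ hd₁]
    have k₂ : j₂ * √q ≤ d₂ := by
      refine abs_le_of_sq_le_sq' ?_ hd₂ |>.2
      rw [mul_pow, hq2]
      linarith [mul_le_mul_of_nonneg_right hjd₂ hq.le,
        mul_le_mul_of_nonneg_right h₂ hd₂]
    have b₁ := sq_le_bound_of_large hm hg₁ hj₁ hs hss k₁ hjg₁ hmn hw
    have b₂ := sq_le_bound_of_small hm hn hj₂ hs hss k₂ hjg₂ hmn hhalf hw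
    rw [hp2] at b₁
    rw [hp2, hq2] at b₂
    rw [abs_le]
    constructor
    · have : 2 * Real.pi * (d₂ ^ 2 / (2 * q * (p + q)) +
          d₂ / (p + q) * (2 * Real.pi * g₂)) * t ≤ 2 * Real.pi * (d₁ * d₂ / (2 * p * (p + q)) +
            d₂ ^ 2 / (2 * q * (p + q)) +
            (d₁ / (2 * p) + d₂ / (p + q)) * (1 + 2 * Real.pi * (g₁ + g₂))) * t := by
        refine mono ?_
        have : d₂ / (p + q) * (2 * Real.pi * g₂) ≤
            (d₁ / (2 * p) + d₂ / (p + q)) * (1 + 2 * Real.pi * (g₁ + g₂)) := by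
          refine mul_le_mul (by linarith) ?_ (by positivity) (by positivity)
          linarith [mul_nonneg hπ.le hg₁]
        linarith
      linarith [sq_nonneg j₁]
    · have : 2 * Real.pi * (d₁ / (2 * p) * (2 * Real.pi * g₁)) * t ≤
          2 * Real.pi * (d₁ * d₂ / (2 * p * (p + q)) +
            d₂ ^ 2 / (2 * q * (p + q)) +
            (d₁ / (2 * p) + d₂ / (p + q)) * (1 + 2 * Real.pi * (g₁ + g₂))) * t := by
        refine mono ?_
        have : d₁ / (2 * p) * (2 * Real.pi * g₁) ≤
            (d₁ / (2 * p) + d₂ / (p + q)) * (1 + 2 * Real.pi * (g₁ + g₂)) := by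
          refine mul_le_mul (by linarith) ?_ (by positivity) (by positivity)
          linarith [mul_nonneg hπ.le hg₂]
        linarith
      linarith [sq_nonneg j₂]

end RealInequality

/-! ### The Lipschitz estimate -/

section LipschitzEstimate

variable {a e : Type*} [Fintype a] [DecidableEq a] [Fintype e] [DecidableEq e]

/-- The chosen symmetric logarithmic derivative in the definition of `qfi`, made available. -/
theorem exists_isSLD_qfi_eq {n : Type*} [Fintype n] [DecidableEq n] {ρ : ℝ → Matrix n n ℂ}
    {α : ℝ} (hρ : (ρ α).PosDef) (hd : (deriv ρ α).IsHermitian) :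
    ∃ L, IsSLD ρ α L ∧ qfi ρ α = (L * ρ α * L).trace.re := by
  have h : ∃ L, IsSLD ρ α L := (existsUnique_isSLD ρ α hρ hd).exists
  refine ⟨h.choose, h.choose_spec, ?_⟩
  rw [qfi, dif_pos h, sq, ← mul_assoc, trace_mul_comm, ← mul_assoc]

/-- The Lipschitz estimate, for a state given as `B * Bᴴ`. -/
theorem abs_qfi_sub_qfi_le [Nonempty a] [Nonempty e] {G₁ G₂ B : Matrix (a × e) (a × e) ℂ} {α : ℝ}
    (hG₁ : G₁.IsHermitian) (hG₂ : G₂.IsHermitian) (hB : (B * Bᴴ).trace = 1)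
    (hα : α ∈ Set.Icc 0 (2 * Real.pi)) (h₁ : (reducedState G₁ (B * Bᴴ) α).PosDef)
    (h₂ : (reducedState G₂ (B * Bᴴ) α).PosDef) :
    |qfi (reducedState G₁ (B * Bᴴ)) α - qfi (reducedState G₂ (B * Bᴴ)) α| ≤
      2 * Real.pi *
        (constC1 (reducedState G₁ (B * Bᴴ)) (reducedState G₂ (B * Bᴴ)) α +
          constC2 (reducedState G₁ (B * Bᴴ)) (reducedState G₂ (B * Bᴴ)) α * (Fintype.card e : ℝ) *
            (1 + 2 * Real.pi * (hsNorm G₁ + hsNorm G₂))) *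
        hsNorm (G₁ - G₂) := by
  have hB1 := hsNorm_eq_one_of_trace hB
  obtain ⟨L₁, hL₁, hJ₁⟩ := exists_isSLD_qfi_eq h₁ (isHermitian_deriv_reducedState G₁ B α)
  obtain ⟨L₂, hL₂, hJ₂⟩ := exists_isSLD_qfi_eq h₂ (isHermitian_deriv_reducedState G₂ B α)
  have hcard : (1 : ℝ) ≤ Fintype.card e := by exact_mod_cast Fintype.card_pos
  have hdiff := fisher_sub_fisher h₁.isHermitian h₂.isHermitian hL₁.1 hL₂.1 hL₁.2 hL₂.2
  have hstate := abs_re_trace_mul_reducedState_sub_le hG₁ hG₂ hB1 hα hL₁.1 hL₂.1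
  have hderiv := hsNorm_deriv_sub_le hG₁ hG₂ hB1 hα
  have htest : ∀ {L : Matrix a a ℂ}, L.IsHermitian →
      |(L * (deriv (reducedState G₁ (B * Bᴴ)) α -
        deriv (reducedState G₂ (B * Bᴴ)) α)).trace.re| ≤
      hsNorm L * ((1 + √2 * Real.pi * (hsNorm G₁ + hsNorm G₂)) * hsNorm (G₁ - G₂)) :=
    fun {L} hL => by
      have h := abs_hsInner_le L (deriv (reducedState G₁ (B * Bᴴ)) α -
        deriv (reducedState G₂ (B * Bᴴ)) α)
      rw [hsInner, hL.eq] at h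
      exact h.trans (mul_le_mul_of_nonneg_left hderiv (hsNorm_nonneg L))
  have hj₁ := re_trace_mul_lyapunov h₁.isHermitian hL₁.1 hL₁.1 hL₁.2 ▸ re_trace_mul_le hL₁.1 _
  have hj₂ := re_trace_mul_lyapunov h₂.isHermitian hL₂.1 hL₂.1 hL₂.2 ▸ re_trace_mul_le hL₂.1 _
  have e₁ := re_trace_mul_reducedState_mul_self (G := G₁) (B := B) (α := α) hL₁.1
  have e₂ := re_trace_mul_reducedState_mul_self (G := G₂) (B := B) (α := α) hL₂.1
  rw [e₁, e₂, Real.sqrt_sq (hsNorm_nonneg _), Real.sqrt_sq (hsNorm_nonneg _)] at hstate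
  rw [e₁, e₂] at hdiff
  rw [e₁] at hj₁
  rw [e₂] at hj₂
  rw [hJ₁, hJ₂, e₁, e₂, constC1, constC2]
  refine abs_sq_sub_sq_le_bound (minEigenvalue_pos h₁) (minEigenvalue_pos h₂)
    (hsNorm_nonneg L₁) (hsNorm_nonneg L₂) (hsNorm_nonneg _) (hsNorm_nonneg _) (hsNorm_nonneg _)
    (hsNorm_nonneg _) (hsNorm_nonneg _) hcard
    (minEigenvalue_mul_hsNorm_le h₁.isHermitian hL₁.1 hL₁.2)
    (minEigenvalue_mul_hsNorm_le h₂.isHermitian hL₂.1 hL₂.2) hj₁ hj₂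
    (hsNorm_amplify_sld_le hG₁ hB1 hL₁) (hsNorm_amplify_sld_le hG₂ hB1 hL₂)
    (sqrt_minEigenvalue_sub_le hG₁ hG₂ hB1 hα)
    (minEigenvalue_le_half_or_eq h₁ h₂ ((trace_reducedState hG₁ B α).trans hB)
      ((trace_reducedState hG₂ B α).trans hB)) ?_
  rw [hdiff]
  refine (abs_sub _ _).trans ((add_le_add ((abs_add_le _ _).trans
    (add_le_add (htest hL₁.1) (htest hL₂.1))) hstate).trans_eq ?_)
  ring

end LipschitzEstimate

/-! ### Continuity -/

section Continuity

open Filter Topology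

theorem continuous_hsNorm {n : Type*} [Fintype n] :
    Continuous (hsNorm : Matrix n n ℂ → ℝ) := by
  have h : (hsNorm : Matrix n n ℂ → ℝ) = fun A => √(∑ i, ∑ j, ‖A i j‖ ^ 2) := by
    ext1 A
    rw [← hsNorm_sq_eq_sum, Real.sqrt_sq (hsNorm_nonneg A)]
  rw [h]
  refine Real.continuous_sqrt.comp ?_
  refine continuous_finsetSum _ fun i _ => continuous_finsetSum _ fun j _ => ?_
  exact ((continuous_id.matrix_elem i j).norm).pow 2

theorem tendsto_of_abs_sub_le_mul {ι : Type*} {l : Filter ι} {f C t : ι → ℝ} {x c : ℝ}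
    (h : ∀ᶠ i in l, |f i - x| ≤ C i * t i) (hC : Tendsto C l (𝓝 c)) (ht : Tendsto t l (𝓝 0)) :
    Tendsto f l (𝓝 x) := by
  rw [tendsto_iff_dist_tendsto_zero]
  have h0 := hC.mul ht
  rw [mul_zero] at h0
  exact squeeze_zero' (Eventually.of_forall fun i => dist_nonneg) h h0

variable {a e : Type*} [Fintype a] [DecidableEq a] [Fintype e] [DecidableEq e]

theorem continuousOn_qfi [Nonempty a] [Nonempty e] {B : Matrix (a × e) (a × e) ℂ} {α : ℝ}
    (hB : (B * Bᴴ).trace = 1) (hα : α ∈ Set.Icc 0 (2 * Real.pi)) :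
    ContinuousOn (fun G : Matrix (a × e) (a × e) ℂ => qfi (reducedState G (B * Bᴴ)) α)
      {G | G.IsHermitian ∧ (reducedState G (B * Bᴴ) α).PosDef} := by
  rintro K ⟨hK, hKpos⟩
  have hB1 := hsNorm_eq_one_of_trace hB
  set s := {G | G.IsHermitian ∧ (reducedState G (B * Bᴴ) α).PosDef}
  have hs : ∀ᶠ G in 𝓝[s] K, G ∈ s := self_mem_nhdsWithin
  have ht : Tendsto (fun G => hsNorm (G - K)) (𝓝[s] K) (𝓝 0) := by
    have hc : Continuous fun G => hsNorm (G - K) :=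
      continuous_hsNorm.comp (continuous_id.sub continuous_const)
    have h0 : hsNorm (K - K) = 0 := by
      rw [sub_self, ← pow_eq_zero_iff two_ne_zero, hsNorm_sq_eq_sum]
      simp
    exact (h0 ▸ hc.tendsto K).mono_left nhdsWithin_le_nhds
  have hg : Tendsto (fun G => hsNorm G) (𝓝[s] K) (𝓝 (hsNorm K)) :=
    (continuous_hsNorm.tendsto K).mono_left nhdsWithin_le_nhds
  have hdG : Tendsto (fun G => hsNorm (deriv (reducedState G (B * Bᴴ)) α)) (𝓝[s] K)
      (𝓝 (hsNorm (deriv (reducedState K (B * Bᴴ)) α))) := by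
    refine tendsto_of_abs_sub_le_mul
      (C := fun G => 1 + √2 * Real.pi * (hsNorm G + hsNorm K)) ?_
      (((hg.add_const (hsNorm K)).const_mul (√2 * Real.pi)).const_add 1) ht
    filter_upwards [hs] with G hG
    refine le_trans ?_ (hsNorm_deriv_sub_le hG.1 hK hB1 hα)
    exact @abs_norm_sub_norm_le _
      (frobeniusNormedAddCommGroup (m := a) (n := a) (α := ℂ)).toSeminormedAddCommGroup
      _ _
  have hpos := minEigenvalue_pos hKpos
  have hlG : Tendsto (fun G => minEigenvalue (reducedState G (B * Bᴴ) α)) (𝓝[s] K)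
      (𝓝 (minEigenvalue (reducedState K (B * Bᴴ) α))) := by
    have hsqrt : Tendsto (fun G => √(minEigenvalue (reducedState G (B * Bᴴ) α))) (𝓝[s] K)
        (𝓝 √(minEigenvalue (reducedState K (B * Bᴴ) α))) := by
      refine tendsto_of_abs_sub_le_mul (C := fun _ => √2 * Real.pi) ?_ tendsto_const_nhds ht
      filter_upwards [hs] with G hG
      have h := sqrt_minEigenvalue_sub_le hK hG.1 hB1 hα
      rw [hsNorm_sub_comm] at h
      exact abs_sub_le_iff.mpr ⟨sqrt_minEigenvalue_sub_le hG.1 hK hB1 hα, h⟩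
    have h2 := hsqrt.pow 2
    rw [Real.sq_sqrt hpos.le] at h2
    refine h2.congr' ?_
    filter_upwards [hs] with G hG
    exact Real.sq_sqrt (minEigenvalue_pos hG.2).le
  have hbound := hs.mono fun G hG => abs_qfi_sub_qfi_le hG.1 hK hB hα hG.2 hKpos
  have hne : (2 : ℝ) * minEigenvalue (reducedState K (B * Bᴴ) α) *
      (minEigenvalue (reducedState K (B * Bᴴ) α) +
        minEigenvalue (reducedState K (B * Bᴴ) α)) ≠ 0 := by positivity
  have hne' : (2 : ℝ) * minEigenvalue (reducedState K (B * Bᴴ) α) ≠ 0 := by positivity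
  have hne'' : minEigenvalue (reducedState K (B * Bᴴ) α) +
    minEigenvalue (reducedState K (B * Bᴴ) α) ≠ 0 := by positivity
  have hsum := hlG.add_const (minEigenvalue (reducedState K (B * Bᴴ) α))
  have hC1 := ((hdG.mul_const (hsNorm (deriv (reducedState K (B * Bᴴ)) α))).div
    ((hlG.const_mul 2).mul hsum) hne).add
    ((tendsto_const_nhds (x := hsNorm (deriv (reducedState K (B * Bᴴ)) α) ^ 2)).div
      (hsum.const_mul (2 * minEigenvalue (reducedState K (B * Bᴴ) α))) hne)
  have hC2 := (hdG.div (hlG.const_mul 2) hne').add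
    ((tendsto_const_nhds (x := hsNorm (deriv (reducedState K (B * Bᴴ)) α))).div hsum hne'')
  exact tendsto_of_abs_sub_le_mul hbound ((hC1.add ((hC2.mul_const (Fintype.card e : ℝ)).mul
    (((hg.add_const (hsNorm K)).const_mul (2 * Real.pi)).const_add 1))).const_mul (2 * Real.pi)) ht

end Continuity

theorem corollary1 {a e : Type*} [Fintype a] [DecidableEq a] [Fintype e] [DecidableEq e]
    (ρ : Matrix (a × e) (a × e) ℂ) (hρ : IsDensity ρ)
    (α : ℝ) (hα : α ∈ Set.Icc (0 : ℝ) (2 * Real.pi)) :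
    (∀ G₁ G₂ : Matrix (a × e) (a × e) ℂ, G₁.IsHermitian → G₂.IsHermitian →
      (reducedState G₁ ρ α).PosDef → (reducedState G₂ ρ α).PosDef →
      |qfi (reducedState G₁ ρ) α - qfi (reducedState G₂ ρ) α| ≤
        2 * Real.pi *
          (constC1 (reducedState G₁ ρ) (reducedState G₂ ρ) α +
            constC2 (reducedState G₁ ρ) (reducedState G₂ ρ) α * (Fintype.card e : ℝ) *
              (1 + 2 * Real.pi * (hsNorm G₁ + hsNorm G₂))) *
          hsNorm (G₁ - G₂)) ∧
    ContinuousOn (fun G : Matrix (a × e) (a × e) ℂ => qfi (reducedState G ρ) α)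
      {G | G.IsHermitian ∧ (reducedState G ρ α).PosDef} := by
  obtain ⟨hpsd, htr⟩ := hρ
  have hne : Nonempty (a × e) := by
    by_contra h
    rw [not_nonempty_iff] at h
    rw [trace, Fintype.sum_empty] at htr
    exact zero_ne_one htr
  obtain ⟨ha, he⟩ := nonempty_prod.mp hne
  obtain ⟨B, rfl⟩ := exists_eq_mul_conjTranspose hpsd
  exact ⟨fun _ _ hG₁ hG₂ h₁ h₂ => abs_qfi_sub_qfi_le hG₁ hG₂ htr hα h₁ h₂,
    continuousOn_qfi htr hα⟩
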